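/- Let $n\ge 1$. A \emph{measure} is a finite signed Borel measure; $\mathcal M(\mathbb R^n)$ is the space of measures on $\mathbb R^n$, and for Borel $A\subset\mathbb R^n$, $\mathcal M(A)$ is identified with the space of measures concentrated on $A$. For $E\subset[n]=\{1,\dots,n\}$ let $P_E:\mathbb R^n\to\mathbb R^n$ set the coordinates outside $E$ to $0$, let $T_E:\mathbb R^n\to\mathbb R^n$ change the sign of the coordinates in $E$, and let $P_E(\mu)$, $T_E(\mu)$ be the image measures. Put $A_E=\{x\in\mathbb R^n: x_i\ne 0\iff i\in E\}$, $B_E=A_E\cap S^{n-1}$, and $R_E(\mu)=\mu_E=\mu(\,\cdot\,\cap A_E)$. Let $$M_{\rm sym}=\tfrac12\,(T_\emptyset+T_{[n]}),\qquad M_{\rm unc}=2^{-n}\sum_{E\subset[n]}T_E .$$ For $\mu$ with $\int\|x\|_2\,|\mu|(dx)<\infty$, let $P_S(\mu)\in\mathcal M(S^{n-1})$ be the radial projection $$P_S(\mu)(B)=\int_{\mathbb R^n\setminus\{0\}}\|x\|_2\,\mathbf 1_B\big(x/\|x\|_2\big)\,\mu(dx),$$ and let $P^S_E=P_S\circ P_E$,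 $P^S_i=P^S_{\{i\}}$. For $\mu,\nu\in\mathcal M(S^{n-1})$ let $\mu*\nu$ be the image of $\mu\otimes\nu$ under the componentwise product $(x,y)\mapsto xy$, and $\mu\circledast\nu=P_S(\mu*\nu)$. A measure $\mu$ is \emph{of order $E$} if $|\mu|(A_E)>0$ and $|\mu|(A_F)=0$ for all $F\ne E$; the \emph{degree} of $\mu\neq0$ is the largest $|E|$ with $\mu_E\ne 0$ (the zero measure has no degree). $\mu$ is \emph{unconditional} if $T_E(\mu)=\mu$ for all $E\subset[n]$, and $\mathcal M_{\rm unc}(A)$ is the set of unconditional $\mu\in\mathcal M(A)$. A measure $\nu\in\mathcal M(S^{n-1})$ is \emph{spherically universal} on $\mathcal A\subset\mathcal M(S^{n-1})$ if, for every $\mu\in\mathcal A$, $\nu\circledast\mu=0$ implies $\mu=0$. **Theorem.** Let $\nu\in\mathcal M(S^{n-1})$. Then: 1. $\nu$ is spherically universal on $\mathcal M_{\rm unc}(B_{[n]})$ if and only if $M_{\rm unc}(\nu)$ has degree $n$. 2. $\nu$ is spherically universal on $\mathcal M_{\rm unc}(S^{n-1})$ if and only if $R_E P^S_E M_{\rm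 unc}(\nu)\neq 0$ for every $E\subset[n]$ with $E\ne\emptyset$. 3. If $\nu$ is of order $[n]$, then $\nu$ is spherically universal on $\mathcal M_{\rm unc}(S^{n-1})$ if and only if $M_{\rm sym}P^S_i(\nu)\ne 0$ for every $i\in[n]$. 4. If $\nu$ is non-negative, then $\nu$ is spherically universal on $\mathcal M_{\rm unc}(S^{n-1})$ if and only if $\nu$ has degree $n$. -/

import Mathlib

open MeasureTheory

noncomputable section

namespace SphConv

/-- Euclidean space `ℝⁿ` with its Euclidean norm and Borel `σ`-field. -/
abbrev Rn (n : ℕ) : Type := EuclideanSpace ℝ (Fin n)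

/-- `ℳ(ℝⁿ)`: finite signed Borel measures on `ℝⁿ`. -/
abbrev SM (n : ℕ) : Type := SignedMeasure (Rn n)

/-! ### Maps and sets in `ℝⁿ` -/

/-- Componentwise product `xy`. -/
def hadamard {n : ℕ} (x y : Rn n) : Rn n := WithLp.toLp 2 fun i => x i * y i

/-- Orthogonal projection `P_E` onto the coordinate subspace `H_E`. -/
def coordProj {n : ℕ} (E : Finset (Fin n)) (x : Rn n) : Rn n :=
  WithLp.toLp 2 fun i => if i ∈ E then x i else 0

/-- Multiple reflection `T_E`: change of sign of the coordinates in `E`. -/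
def reflection {n : ℕ} (E : Finset (Fin n)) (x : Rn n) : Rn n :=
  WithLp.toLp 2 fun i => if i ∈ E then -x i else x i

/-- `x ↦ x / ‖x‖`, with value `0` at the origin (which the radial projection never charges). -/
def radialMap {n : ℕ} (x : Rn n) : Rn n := ‖x‖⁻¹ • x

/-- `S^{n-1}`. -/
def unitSphere (n : ℕ) : Set (Rn n) := Metric.sphere 0 1

/-- `A_E`: the points whose non-zero coordinates are exactly those in `E`. -/
def stratum {n : ℕ} (E : Finset (Fin n)) : Set (Rn n) := {x | ∀ i, x i ≠ 0 ↔ i ∈ E}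

/-- `B_E = A_E ∩ S^{n-1}`. -/
def sphStratum {n : ℕ} (E : Finset (Fin n)) : Set (Rn n) := stratum E ∩ unitSphere n

theorem measurable_hadamard {n : ℕ} :
    Measurable fun p : Rn n × Rn n => hadamard p.1 p.2 := by
  unfold hadamard
  fun_prop

theorem measurable_coordProj {n : ℕ} (E : Finset (Fin n)) : Measurable (coordProj E) := by
  unfold coordProj
  refine (WithLp.measurable_toLp 2 _).comp (measurable_pi_lambda _ fun i => ?_)
  split_ifs <;> fun_prop

theorem measurable_reflection {n : ℕ} (E : Finset (Fin n)) : Measurable (reflection E) := by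
  unfold reflection
  refine (WithLp.measurable_toLp 2 _).comp (measurable_pi_lambda _ fun i => ?_)
  split_ifs <;> fun_prop

theorem measurable_radialMap {n : ℕ} : Measurable (radialMap (n := n)) := by
  unfold radialMap
  fun_prop

theorem measurableSet_stratum {n : ℕ} (E : Finset (Fin n)) : MeasurableSet (stratum E) := by
  have h : stratum E = ⋂ i, {x : Rn n | x i ≠ 0 ↔ i ∈ E} := by
    ext x; simp [stratum]
  rw [h]
  refine MeasurableSet.iInter fun i => ?_
  have h0 : MeasurableSet {x : Rn n | x i = 0} :=
    measurableSet_eq_fun (by fun_prop) measurable_const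
  by_cases hi : i ∈ E
  · have h1 : {x : Rn n | x i ≠ 0 ↔ i ∈ E} = {x : Rn n | x i = 0}ᶜ := by
      ext x; simp [hi]
    rw [h1]
    exact h0.compl
  · simpa [hi] using h0

/-! ### Operations on measures -/

/-- `μ` is concentrated on `A`; `ℳ(A)` is identified with the space of these measures. -/
def ConcentratedOn {n : ℕ} (μ : SM n) (A : Set (Rn n)) : Prop :=
  ∀ B : Set (Rn n), MeasurableSet B → B ⊆ Aᶜ → μ B = 0

/-- Every finite signed measure has finite total variation; hence products always exist. -/
instance isFiniteMeasure_variation {α : Type*} [MeasurableSpace α] (μ : SignedMeasure α) :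
    IsFiniteMeasure μ.variation := by
  rw [← SignedMeasure.totalVariation_eq_variation]
  unfold SignedMeasure.totalVariation
  infer_instance

/-- Multiplicative convolution: the image of the product measure under `(x, y) ↦ xy`. -/
def mulConv {n : ℕ} (μ ν : SM n) : SM n :=
  (μ.prod ν (ContinuousLinearMap.lsmul ℝ ℝ)).map fun p => hadamard p.1 p.2

/-- The defining double integral of the multiplicative convolution. -/
theorem mulConv_apply {n : ℕ} (μ ν : SM n) {A : Set (Rn n)} (hA : MeasurableSet A) :
    mulConv μ ν A = ∫ᵛ x, (∫ᵛ y, A.indicator (fun _ => (1 : ℝ)) (hadamard x y) ∂•ν) ∂<•μ := by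
  rw [mulConv, VectorMeasure.map_apply _ measurable_hadamard hA,
    VectorMeasure.prod_apply_eq_integral (measurable_hadamard hA)]
  congr 1
  ext x
  have hm : MeasurableSet {y : Rn n | hadamard x y ∈ A} :=
    (measurable_hadamard.comp measurable_prodMk_left) hA
  have h : (fun y => A.indicator (fun _ => (1 : ℝ)) (hadamard x y)) =
      {y : Rn n | hadamard x y ∈ A}.indicator fun _ => (1 : ℝ) := rfl
  rw [h, VectorMeasure.integral_indicator hm, VectorMeasure.integral_const]
  simp
  rfl

/-- Radial projection `P_S`: the image under `x ↦ x / ‖x‖` of the measure with density `‖x‖`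
with respect to `μ`, for integrable `μ` (and `0` for other `μ`). -/
def radialProj {n : ℕ} (μ : SM n) : SM n :=
  (μ.withDensity (fun x => ‖x‖) (ContinuousLinearMap.lsmul ℝ ℝ)).map radialMap

theorem radialProj_apply {n : ℕ} (μ : SM n) (hμ : Integrable (fun x => ‖x‖) μ.variation)
    {B : Set (Rn n)} (hB : MeasurableSet B) :
    radialProj μ B = ∫ᵛ x in radialMap ⁻¹' B, ‖x‖ ∂•μ := by
  rw [radialProj, VectorMeasure.map_apply _ measurable_radialMap hB,
    VectorMeasure.withDensity_apply hμ]

/-- Spherical multiplicative convolution `P_S(μ * ν)`. -/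
def sphConv {n : ℕ} (μ ν : SM n) : SM n := radialProj (mulConv μ ν)

/-- The marginal measure `P_E(μ)`. -/
def projMeasure {n : ℕ} (E : Finset (Fin n)) (μ : SM n) : SM n := μ.map (coordProj E)

/-- `P^S_E = P_S ∘ P_E`. -/
def sphProj {n : ℕ} (E : Finset (Fin n)) (μ : SM n) : SM n := radialProj (projMeasure E μ)

/-- `R_E(μ) = μ_E = μ(· ∩ A_E)`. -/
def coordPart {n : ℕ} (E : Finset (Fin n)) (μ : SM n) : SM n := μ.restrict (stratum E)

/-- The image `T_E(μ)`. -/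
def reflMeasure {n : ℕ} (E : Finset (Fin n)) (μ : SM n) : SM n := μ.map (reflection E)

/-- `M_sym = (T_∅ + T_[n]) / 2`. -/
def symAverage {n : ℕ} (μ : SM n) : SM n :=
  (1 / 2 : ℝ) • (reflMeasure ∅ μ + reflMeasure Finset.univ μ)

/-- `M_unc = 2⁻ⁿ ∑_E T_E`. -/
def uncAverage {n : ℕ} (μ : SM n) : SM n :=
  ((2 : ℝ) ^ n)⁻¹ • ∑ E : Finset (Fin n), reflMeasure E μ

/-! ### Order, degree, unconditionality, universality -/

/-- `μ` is of order `E`. -/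
def IsOfOrder {n : ℕ} (μ : SM n) (E : Finset (Fin n)) : Prop :=
  0 < μ.variation (stratum E) ∧ ∀ F : Finset (Fin n), F ≠ E → μ.variation (stratum F) = 0

/-- `μ` has degree `k`: `k` is the largest `|E|` with `μ_E ≠ 0` (the zero measure has no degree). -/
def HasDegree {n : ℕ} (μ : SM n) (k : ℕ) : Prop :=
  IsGreatest {m : ℕ | ∃ E : Finset (Fin n), E.card = m ∧ coordPart E μ ≠ 0} k

/-- `μ` is unconditional: even under all multiple reflections. -/
def IsUnconditional {n : ℕ} (μ : SM n) : Prop := ∀ E : Finset (Fin n), reflMeasure E μ = μ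

/-- `ℳ_unc(A)`. -/
def uncMeasures {n : ℕ} (A : Set (Rn n)) : Set (SM n) :=
  {μ | ConcentratedOn μ A ∧ IsUnconditional μ}

/-- `ν` is spherically universal on `𝒜`. -/
def SphericallyUniversal {n : ℕ} (ν : SM n) (𝒜 : Set (SM n)) : Prop :=
  ∀ μ ∈ 𝒜, sphConv ν μ = 0 → μ = 0

end SphConv

end

/-! The proof is a Mellin transform argument. For non-empty `E` and positive exponents `a` on `E`
with sum one, the monomial `∏_{i ∈ E} |x_i|^{a_i}` is multiplicative for the componentwise product,
homogeneous of degree one and invariant under reflections. Its integral therefore turns `*` into a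
product, survives the radial projection (the density `‖x‖` is exactly what homogeneity needs) and
ignores `M_unc`. Thus the moments of `ν ⊛ μ` are the products of those of `ν` and `μ`
(`moment_sphConv`).

Two facts make this decisive. Unconditional measures on the sphere are determined by their moments
(`eq_zero_of_forall_moment_eq_zero`): on one stratum, by analytic continuation to characteristic
functions of logarithms; in general, through a maximal stratum that is charged. Moreover, moments
are analytic along segments of exponents, so a product of two moment functions of type `E` vanishes
identically only if one factor does (`moment_eq_zero_or_of_mul_eq_zero`).

Hence `ν` is universal on the whole sphere exactly when, for each non-empty `E`, its moments of type
`E` are not all zero, and on `B_[n]` exactly when this holds for `E = [n]`. Necessity uses a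
non-zero unconditional measure on `B_E` whose moments of every type other than `E` vanish
(`exists_uncMeasure`).

The four criteria restate this. Moments of type `[n]` see only the part on `A_[n]`; those of type
`E` are the moments of `R_E P^S_E M_unc(ν)`; for order `[n]` one lets the exponents tend to a vertex
of the simplex; for `ν ≥ 0` the monomials are positive on `A_[n]`. -/

noncomputable section

namespace SphConv

/-! ### Integration against signed measures -/

section Sint

variable {α β : Type*} [MeasurableSpace α] [MeasurableSpace β]

/-- The integral of a real function against a signed measure. -/
def sint (ν : SignedMeasure α) (f : α → ℝ) : ℝ := ∫ᵛ x, f x ∂<•ν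

theorem lsmul_flip_real :
    (ContinuousLinearMap.lsmul ℝ ℝ : ℝ →L[ℝ] ℝ →L[ℝ] ℝ).flip = ContinuousLinearMap.lsmul ℝ ℝ := by
  ext
  simp

theorem integrable_posPart {ν : SignedMeasure α} {f : α → ℝ} (hf : ν.Integrable f) :
    Integrable f ν.toJordanDecomposition.posPart := by
  refine Integrable.mono_measure hf ?_
  rw [← SignedMeasure.totalVariation_eq_variation]
  exact Measure.le_add_right le_rfl

theorem integrable_negPart {ν : SignedMeasure α} {f : α → ℝ} (hf : ν.Integrable f) :
    Integrable f ν.toJordanDecomposition.negPart := by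
  refine Integrable.mono_measure hf ?_
  rw [← SignedMeasure.totalVariation_eq_variation]
  exact Measure.le_add_left le_rfl

theorem eq_toSignedMeasure_sub (ν : SignedMeasure α) :
    ν = ν.toJordanDecomposition.posPart.toSignedMeasure -
      ν.toJordanDecomposition.negPart.toSignedMeasure :=
  (SignedMeasure.toSignedMeasure_toJordanDecomposition ν).symm

theorem sint_toSignedMeasure_sub {p q : Measure α} [IsFiniteMeasure p] [IsFiniteMeasure q]
    {f : α → ℝ} (hp : Integrable f p) (hq : Integrable f q) :
    sint (p.toSignedMeasure - q.toSignedMeasure) f = ∫ x, f x ∂p - ∫ x, f x ∂q := by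
  rw [sint, VectorMeasure.integral_sub_vectorMeasure]
  · simp
  · simpa [VectorMeasure.Integrable] using hp
  · simpa [VectorMeasure.Integrable] using hq

theorem sint_eq_sub {ν : SignedMeasure α} {f : α → ℝ} (hf : ν.Integrable f) :
    sint ν f = ∫ x, f x ∂ν.toJordanDecomposition.posPart -
      ∫ x, f x ∂ν.toJordanDecomposition.negPart := by
  conv_lhs => rw [eq_toSignedMeasure_sub ν]
  exact sint_toSignedMeasure_sub (integrable_posPart hf) (integrable_negPart hf)

theorem sint_map {ν : SignedMeasure α} {φ : α → β} (hφ : Measurable φ) {g : β → ℝ}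
    (hg : Measurable g) (hi : ν.Integrable (g ∘ φ)) : sint (ν.map φ) g = sint ν (g ∘ φ) :=
  VectorMeasure.integral_map hφ hg.aestronglyMeasurable hi

theorem sint_indicator_one (ν : SignedMeasure α) {B : Set α} (hB : MeasurableSet B) :
    sint ν (B.indicator fun _ => 1) = ν B := by
  rw [sint, VectorMeasure.integral_indicator hB, VectorMeasure.integral_const]
  simp [VectorMeasure.restrict_apply _ hB]

theorem sint_restrict (ν : SignedMeasure α) {A : Set α} (hA : MeasurableSet A) (f : α → ℝ) :
    sint (ν.restrict A) f = sint ν (A.indicator f) := by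
  rw [sint, sint, VectorMeasure.integral_indicator hA]

theorem integrable_of_bounded (ν : SignedMeasure α) {f : α → ℝ} (hf : Measurable f) (C : ℝ)
    (h : ∀ x, |f x| ≤ C) : ν.Integrable f :=
  Integrable.of_bound hf.aestronglyMeasurable C (Filter.Eventually.of_forall h)

theorem ae_variation_iff {ν : SignedMeasure α} {A : Set α} (hA : MeasurableSet A) :
    (∀ᵐ x ∂ν.variation, x ∈ A) ↔ ∀ B : Set α, MeasurableSet B → B ⊆ Aᶜ → ν B = 0 := by
  rw [ae_iff]
  change ν.variation Aᶜ = 0 ↔ _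
  rw [VectorMeasure.variation_apply_eq_zero hA.compl]
  exact ⟨fun h B hB hBA => h B hBA hB, fun h B hBA hB => h B hB hBA⟩

/-- Expand the product of the two Jordan decompositions; agreement on rectangles suffices. This
reduces product integrals to those of positive measures. -/
theorem prod_eq_toSignedMeasure_sub (ν : SignedMeasure α) (μ : SignedMeasure β) :
    ν.prod μ (ContinuousLinearMap.lsmul ℝ ℝ) =
      (ν.toJordanDecomposition.posPart.prod μ.toJordanDecomposition.posPart +
        ν.toJordanDecomposition.negPart.prod μ.toJordanDecomposition.negPart).toSignedMeasure -
      (ν.toJordanDecomposition.posPart.prod μ.toJordanDecomposition.negPart +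
        ν.toJordanDecomposition.negPart.prod μ.toJordanDecomposition.posPart).toSignedMeasure := by
  refine VectorMeasure.prod_eq_of_forall_apply_prod fun s t hs ht => ?_
  rw [_root_.sub_apply, Measure.toSignedMeasure_apply_measurable (hs.prod ht),
    Measure.toSignedMeasure_apply_measurable (hs.prod ht), measureReal_add_apply,
    measureReal_add_apply, ν.apply_eq_posPart_real_sub_negPart_real hs,
    μ.apply_eq_posPart_real_sub_negPart_real ht]
  simp only [measureReal_prod_prod, ContinuousLinearMap.lsmul_apply, smul_eq_mul]
  ring

theorem sint_prod_mul {ν : SignedMeasure α} {μ : SignedMeasure β} {f : α → ℝ} {g : β → ℝ}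
    (hf : ν.Integrable f) (hg : μ.Integrable g) :
    sint (ν.prod μ (ContinuousLinearMap.lsmul ℝ ℝ)) (fun z => f z.1 * g z.2) =
      sint ν f * sint μ g := by
  have hpp := (integrable_posPart hf).mul_prod (integrable_posPart hg)
  have hpn := (integrable_posPart hf).mul_prod (integrable_negPart hg)
  have hnp := (integrable_negPart hf).mul_prod (integrable_posPart hg)
  have hnn := (integrable_negPart hf).mul_prod (integrable_negPart hg)
  rw [prod_eq_toSignedMeasure_sub, sint_toSignedMeasure_sub (hpp.add_measure hnn)
    (hpn.add_measure hnp), integral_add_measure hpp hnn, integral_add_measure hpn hnp,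
    integral_prod_mul, integral_prod_mul, integral_prod_mul, integral_prod_mul,
    sint_eq_sub hf, sint_eq_sub hg]
  ring

theorem integrable_prod_mul {ν : SignedMeasure α} {μ : SignedMeasure β} {f : α → ℝ} {g : β → ℝ}
    (hf : ν.Integrable f) (hg : μ.Integrable g) :
    (ν.prod μ (ContinuousLinearMap.lsmul ℝ ℝ)).Integrable fun z => f z.1 * g z.2 := by
  have h : Integrable (fun z : α × β => f z.1 * g z.2) (ν.variation.prod μ.variation) :=
    hf.mul_prod hg
  exact (h.smul_measure (enorm_ne_top (x := ContinuousLinearMap.lsmul ℝ ℝ))).mono_measure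
    VectorMeasure.variation_prod_le

/-- `p` and `q` are variables tied by equations so that their finiteness, which depends on `hi`, can
enter as instances. -/
theorem withDensity_eq_toSignedMeasure_sub {ν : SignedMeasure α} {w : α → ℝ} (hw : Measurable w)
    (hw0 : 0 ≤ w) (hi : ν.Integrable w) (p q : Measure α) [IsFiniteMeasure p] [IsFiniteMeasure q]
    (hp : p = ν.toJordanDecomposition.posPart.withDensity fun x => ENNReal.ofReal (w x))
    (hq : q = ν.toJordanDecomposition.negPart.withDensity fun x => ENNReal.ofReal (w x)) :
    ν.withDensity w (ContinuousLinearMap.lsmul ℝ ℝ) = p.toSignedMeasure - q.toSignedMeasure := by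
  ext s hs
  have key (m : Measure α) (hm : Integrable w m) :
      (m.withDensity fun x => ENNReal.ofReal (w x)).real s = ∫ x, s.indicator w x ∂m := by
    rw [measureReal_def, withDensity_apply _ hs, integral_indicator hs,
      integral_eq_lintegral_of_nonneg_ae (Filter.Eventually.of_forall hw0)
        hw.aestronglyMeasurable]
  have h1 : ν.Integrable (s.indicator w) := Integrable.indicator hi hs
  rw [VectorMeasure.withDensity_apply hi, _root_.sub_apply,
    Measure.toSignedMeasure_apply_measurable hs, Measure.toSignedMeasure_apply_measurable hs,
    hp, hq, key _ (integrable_posPart hi), key _ (integrable_negPart hi), ← sint_eq_sub h1,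
    ← sint_restrict _ hs, sint, lsmul_flip_real]

theorem isFiniteMeasure_withDensity_of_integrable {m : Measure α} {w : α → ℝ}
    (hw : Integrable w m) : IsFiniteMeasure (m.withDensity fun x => ENNReal.ofReal (w x)) :=
  isFiniteMeasure_withDensity_ofReal hw.2

theorem integral_withDensity_ofReal {m : Measure α} {w : α → ℝ} (hw : Measurable w)
    (hw0 : 0 ≤ w) (g : α → ℝ) :
    ∫ x, g x ∂(m.withDensity fun x => ENNReal.ofReal (w x)) = ∫ x, w x * g x ∂m := by
  rw [integral_withDensity_eq_integral_toReal_smul hw.ennreal_ofReal (by simp)]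
  refine integral_congr_ae (Filter.Eventually.of_forall fun x => ?_)
  simp [ENNReal.toReal_ofReal (hw0 x)]

theorem integrable_withDensity_ofReal {m : Measure α} {w : α → ℝ} (hw : Measurable w)
    (hw0 : 0 ≤ w) {g : α → ℝ} :
    Integrable g (m.withDensity fun x => ENNReal.ofReal (w x)) ↔
      Integrable (fun x => w x * g x) m := by
  rw [integrable_withDensity_iff_integrable_smul' hw.ennreal_ofReal (by simp)]
  refine integrable_congr (Filter.Eventually.of_forall fun x => ?_)
  simp [ENNReal.toReal_ofReal (hw0 x)]

theorem sint_withDensity {ν : SignedMeasure α} {w : α → ℝ} (hw : Measurable w) (hw0 : 0 ≤ w)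
    (hi : ν.Integrable w) {g : α → ℝ} (hg : ν.Integrable fun x => w x * g x) :
    sint (ν.withDensity w (ContinuousLinearMap.lsmul ℝ ℝ)) g = sint ν fun x => w x * g x := by
  have := isFiniteMeasure_withDensity_of_integrable (integrable_posPart hi)
  have := isFiniteMeasure_withDensity_of_integrable (integrable_negPart hi)
  rw [withDensity_eq_toSignedMeasure_sub hw hw0 hi _ _ rfl rfl, sint_toSignedMeasure_sub
    ((integrable_withDensity_ofReal hw hw0).2 (integrable_posPart hg))
    ((integrable_withDensity_ofReal hw hw0).2 (integrable_negPart hg)),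
    integral_withDensity_ofReal hw hw0, integral_withDensity_ofReal hw hw0, sint_eq_sub hg]

theorem integrable_withDensity {ν : SignedMeasure α} {w : α → ℝ} (hw : Measurable w) (hw0 : 0 ≤ w)
    {g : α → ℝ} (hg : ν.Integrable fun x => w x * g x) :
    (ν.withDensity w (ContinuousLinearMap.lsmul ℝ ℝ)).Integrable g := by
  have h : Integrable g (ν.variation.withDensity fun x => ENNReal.ofReal (w x)) :=
    (integrable_withDensity_ofReal hw hw0).2 hg
  refine Integrable.mono_measure h ?_
  refine VectorMeasure.variation_WithDensity_le.trans ?_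
  rw [VectorMeasure.variation_transpose_lsmul]
  refine le_of_eq ?_
  congr 1
  ext x
  rw [Real.enorm_of_nonneg (hw0 x)]

end Sint

variable {n : ℕ}

/-! ### Monomials of degree one -/

/-- The exponents `a` are positive on `E` and sum to one there. -/
def Admissible (E : Finset (Fin n)) (a : Fin n → ℝ) : Prop :=
  (∀ i ∈ E, 0 < a i) ∧ ∑ i ∈ E, a i = 1

/-- The monomial `∏_{i ∈ E} |x_i|^{a_i}`. -/
def mono (E : Finset (Fin n)) (a : Fin n → ℝ) (x : Rn n) : ℝ := ∏ i ∈ E, |x i| ^ a i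

/-- The vector of absolute values of the coordinates. -/
def absVec (x : Rn n) : Rn n := WithLp.toLp 2 fun i => |x i|

@[simp] theorem hadamard_apply (x y : Rn n) (i : Fin n) : hadamard x y i = x i * y i := rfl

@[simp] theorem coordProj_apply (E : Finset (Fin n)) (x : Rn n) (i : Fin n) :
    coordProj E x i = if i ∈ E then x i else 0 := rfl

@[simp] theorem reflection_apply (E : Finset (Fin n)) (x : Rn n) (i : Fin n) :
    reflection E x i = if i ∈ E then -x i else x i := rfl

@[simp] theorem absVec_apply (x : Rn n) (i : Fin n) : absVec x i = |x i| := rfl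

@[simp] theorem radialMap_apply (x : Rn n) (i : Fin n) : radialMap x i = ‖x‖⁻¹ * x i := rfl

theorem abs_reflection_apply (E : Finset (Fin n)) (x : Rn n) (i : Fin n) :
    |reflection E x i| = |x i| := by
  rw [reflection_apply]
  split_ifs <;> simp

theorem norm_le_of_abs_le {x y : Rn n} (h : ∀ i, |x i| ≤ |y i|) : ‖x‖ ≤ ‖y‖ := by
  rw [EuclideanSpace.norm_eq, EuclideanSpace.norm_eq]
  gcongr with i
  exact h i

theorem norm_eq_of_abs_eq {x y : Rn n} (h : ∀ i, |x i| = |y i|) : ‖x‖ = ‖y‖ :=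
  le_antisymm (norm_le_of_abs_le fun i => (h i).le) (norm_le_of_abs_le fun i => (h i).ge)

theorem abs_apply_le_norm (x : Rn n) (i : Fin n) : |x i| ≤ ‖x‖ := PiLp.norm_apply_le x i

theorem norm_reflection (E : Finset (Fin n)) (x : Rn n) : ‖reflection E x‖ = ‖x‖ :=
  norm_eq_of_abs_eq (abs_reflection_apply E x)

theorem norm_coordProj_le (E : Finset (Fin n)) (x : Rn n) : ‖coordProj E x‖ ≤ ‖x‖ := by
  refine norm_le_of_abs_le fun i => ?_
  rw [coordProj_apply]
  split_ifs <;> simp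

theorem norm_hadamard_le (x y : Rn n) : ‖hadamard x y‖ ≤ ‖x‖ * ‖y‖ := by
  have h : ‖hadamard x y‖ ≤ ‖‖x‖ • y‖ := by
    refine norm_le_of_abs_le fun i => ?_
    rw [hadamard_apply, abs_mul, PiLp.smul_apply, smul_eq_mul, abs_mul, abs_norm]
    exact mul_le_mul_of_nonneg_right (abs_apply_le_norm x i) (abs_nonneg _)
  rwa [norm_smul, norm_norm] at h

theorem measurable_mono (E : Finset (Fin n)) (a : Fin n → ℝ) : Measurable (mono E a) := by
  unfold mono
  fun_prop

theorem mono_nonneg (E : Finset (Fin n)) (a : Fin n → ℝ) (x : Rn n) : 0 ≤ mono E a x :=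
  Finset.prod_nonneg fun _ _ => Real.rpow_nonneg (abs_nonneg _) _

theorem mono_congr {E : Finset (Fin n)} {a : Fin n → ℝ} {x y : Rn n}
    (h : ∀ i ∈ E, |x i| = |y i|) : mono E a x = mono E a y :=
  Finset.prod_congr rfl fun i hi => by rw [h i hi]

theorem mono_reflection (E F : Finset (Fin n)) (a : Fin n → ℝ) (x : Rn n) :
    mono E a (reflection F x) = mono E a x :=
  mono_congr fun i _ => abs_reflection_apply F x i

theorem mono_absVec (E : Finset (Fin n)) (a : Fin n → ℝ) (x : Rn n) :
    mono E a (absVec x) = mono E a x :=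
  mono_congr fun i _ => by simp

theorem mono_coordProj (E : Finset (Fin n)) (a : Fin n → ℝ) (x : Rn n) :
    mono E a (coordProj E x) = mono E a x :=
  mono_congr fun i hi => by simp [hi]

theorem mono_hadamard (E : Finset (Fin n)) (a : Fin n → ℝ) (x y : Rn n) :
    mono E a (hadamard x y) = mono E a x * mono E a y := by
  simp only [mono, hadamard_apply, abs_mul]
  rw [← Finset.prod_mul_distrib]
  exact Finset.prod_congr rfl fun i _ => Real.mul_rpow (abs_nonneg _) (abs_nonneg _)

theorem prod_rpow_of_admissible {E : Finset (Fin n)} {a : Fin n → ℝ} (ha : Admissible E a)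
    {c : ℝ} (hc : 0 ≤ c) : ∏ i ∈ E, c ^ a i = c := by
  rcases hc.eq_or_lt with rfl | hc
  · obtain ⟨i, hi⟩ : E.Nonempty := by
      rw [Finset.nonempty_iff_ne_empty]
      rintro rfl
      simpa using ha.2
    exact Finset.prod_eq_zero hi (Real.zero_rpow (ha.1 i hi).ne')
  · rw [← Real.rpow_sum_of_pos hc, ha.2, Real.rpow_one]

theorem mono_smul {E : Finset (Fin n)} {a : Fin n → ℝ} (ha : Admissible E a)
    {c : ℝ} (hc : 0 ≤ c) (x : Rn n) : mono E a (c • x) = c * mono E a x := by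
  conv_rhs => rw [← prod_rpow_of_admissible ha hc]
  simp only [mono, PiLp.smul_apply, smul_eq_mul, abs_mul, abs_of_nonneg hc]
  rw [← Finset.prod_mul_distrib]
  exact Finset.prod_congr rfl fun i _ => Real.mul_rpow hc (abs_nonneg _)

theorem mono_le_norm {E : Finset (Fin n)} {a : Fin n → ℝ} (ha : Admissible E a) (x : Rn n) :
    mono E a x ≤ ‖x‖ := by
  rw [← prod_rpow_of_admissible ha (norm_nonneg x)]
  exact Finset.prod_le_prod (fun _ _ => Real.rpow_nonneg (abs_nonneg _) _) fun i hi =>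
    Real.rpow_le_rpow (abs_nonneg _) (abs_apply_le_norm x i) (ha.1 i hi).le

theorem mono_eq_zero_iff {E : Finset (Fin n)} {a : Fin n → ℝ} (ha : ∀ i ∈ E, 0 < a i)
    (x : Rn n) : mono E a x = 0 ↔ ∃ i ∈ E, x i = 0 := by
  rw [mono, Finset.prod_eq_zero_iff]
  refine exists_congr fun i => and_congr_right fun hi => ?_
  rw [Real.rpow_eq_zero (abs_nonneg _) (ha i hi).ne', abs_eq_zero]

/-- Degree-one homogeneity compensates exactly for the density `‖x‖` in the radial projection, so
that projection preserves all moments. -/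
theorem norm_mul_mono_radialMap {E : Finset (Fin n)} {a : Fin n → ℝ} (ha : Admissible E a)
    (x : Rn n) : ‖x‖ * mono E a (radialMap x) = mono E a x := by
  rw [radialMap, mono_smul ha (by positivity), ← mul_assoc]
  rcases eq_or_ne x 0 with rfl | hx
  · have := mono_le_norm ha (0 : Rn n)
    have h0 := mono_nonneg E a (0 : Rn n)
    rw [norm_zero] at this
    simp [le_antisymm this h0]
  · rw [mul_inv_cancel₀ (norm_ne_zero_iff.2 hx), one_mul]

/-! ### Integrability of the norm -/

/-- The norm is integrable with respect to `ν`. -/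
def NormIntegrable (ν : SM n) : Prop := ν.Integrable fun x => ‖x‖

theorem NormIntegrable.of_le {ν : SM n} (h : NormIntegrable ν) {g : Rn n → ℝ} (hg : Measurable g)
    (hle : ∀ x, |g x| ≤ ‖x‖) : ν.Integrable g :=
  Integrable.mono' h hg.aestronglyMeasurable (Filter.Eventually.of_forall hle)

theorem NormIntegrable.norm_mul {ν : SM n} (h : NormIntegrable ν) {g : Rn n → ℝ}
    (hg : Measurable g) (hle : ∀ x, |g x| ≤ 1) : ν.Integrable fun x => ‖x‖ * g x := by
  refine h.of_le (by fun_prop) fun x => ?_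
  rw [abs_mul, abs_norm]
  exact mul_le_of_le_one_right (norm_nonneg x) (hle x)

theorem NormIntegrable.mono {ν : SM n} (h : NormIntegrable ν) {E : Finset (Fin n)}
    {a : Fin n → ℝ} (ha : Admissible E a) : ν.Integrable (mono E a) :=
  h.of_le (measurable_mono E a) fun x => by
    rw [abs_of_nonneg (mono_nonneg E a x)]
    exact mono_le_norm ha x

theorem NormIntegrable.map {ν : SM n} (h : NormIntegrable ν) {φ : Rn n → Rn n}
    (hφ : Measurable φ) (hle : ∀ x, ‖φ x‖ ≤ ‖x‖) : NormIntegrable (ν.map φ) := by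
  refine VectorMeasure.Integrable.map measurable_norm.aestronglyMeasurable
    (h.of_le (measurable_norm.comp hφ) fun x => ?_)
  simpa using hle x

theorem NormIntegrable.smul {ν : SM n} (h : NormIntegrable ν) (c : ℝ) :
    NormIntegrable (c • ν) := VectorMeasure.Integrable.smul_vectorMeasure h c

theorem NormIntegrable.sum {ι : Type*} {s : Finset ι} {ν : ι → SM n}
    (h : ∀ i ∈ s, NormIntegrable (ν i)) : NormIntegrable (∑ i ∈ s, ν i) :=
  VectorMeasure.Integrable.finsetSum_vectorMeasure h

theorem measurableSet_unitSphere : MeasurableSet (unitSphere n) := Metric.isClosed_sphere.measurableSet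

theorem mem_unitSphere {x : Rn n} : x ∈ unitSphere n ↔ ‖x‖ = 1 := mem_sphere_zero_iff_norm

theorem measurableSet_sphStratum (E : Finset (Fin n)) : MeasurableSet (sphStratum E) :=
  (measurableSet_stratum E).inter measurableSet_unitSphere

theorem ConcentratedOn.ae {ν : SM n} {A : Set (Rn n)} (hA : MeasurableSet A)
    (h : ConcentratedOn ν A) : ∀ᵐ x ∂ν.variation, x ∈ A := (ae_variation_iff hA).2 h

theorem ConcentratedOn.mono {ν : SM n} {A B : Set (Rn n)} (h : ConcentratedOn ν A)
    (hAB : A ⊆ B) : ConcentratedOn ν B :=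
  fun C hC hCB => h C hC (hCB.trans (Set.compl_subset_compl.2 hAB))

theorem ConcentratedOn.normIntegrable {ν : SM n} (h : ConcentratedOn ν (unitSphere n)) :
    NormIntegrable ν :=
  Integrable.of_bound measurable_norm.aestronglyMeasurable 1
    ((h.ae measurableSet_unitSphere).mono fun x hx => by simp [mem_unitSphere.1 hx])

theorem NormIntegrable.mulConv {ν μ : SM n} (hν : NormIntegrable ν) (hμ : NormIntegrable μ) :
    NormIntegrable (mulConv ν μ) := by
  refine VectorMeasure.Integrable.map measurable_norm.aestronglyMeasurable ?_
  refine Integrable.mono' (integrable_prod_mul hν hμ)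
    (measurable_norm.comp measurable_hadamard).aestronglyMeasurable
    (Filter.Eventually.of_forall fun z => ?_)
  simpa using norm_hadamard_le z.1 z.2

/-! ### Radial projection -/

theorem sint_radialProj {ρ : SM n} (hρ : NormIntegrable ρ) {g : Rn n → ℝ} (hg : Measurable g)
    (hi : ρ.Integrable fun x => ‖x‖ * g (radialMap x)) :
    sint (radialProj ρ) g = sint ρ fun x => ‖x‖ * g (radialMap x) := by
  rw [radialProj, sint_map measurable_radialMap hg
    (integrable_withDensity measurable_norm (norm_nonneg) hi)]
  exact sint_withDensity measurable_norm (norm_nonneg) hρ hi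

theorem sint_radialProj_of_le_one {ρ : SM n} (hρ : NormIntegrable ρ) {g : Rn n → ℝ}
    (hg : Measurable g) (h1 : ∀ x, |g x| ≤ 1) :
    sint (radialProj ρ) g = sint ρ fun x => ‖x‖ * g (radialMap x) :=
  sint_radialProj hρ hg (hρ.norm_mul (hg.comp measurable_radialMap) fun _ => h1 _)

theorem indicator_le_one {α : Type*} (B : Set α) (x : α) :
    |B.indicator (fun _ => (1 : ℝ)) x| ≤ 1 := by
  by_cases h : x ∈ B <;> simp [h]

theorem radialProj_apply_eq_sint {ρ : SM n} (hρ : NormIntegrable ρ) {B : Set (Rn n)}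
    (hB : MeasurableSet B) :
    radialProj ρ B = sint ρ fun x => ‖x‖ * B.indicator (fun _ => 1) (radialMap x) := by
  rw [← sint_indicator_one _ hB, sint_radialProj_of_le_one hρ (measurable_const.indicator hB)
    (indicator_le_one B)]

theorem radialMap_mem_sphStratum {E : Finset (Fin n)} {x : Rn n} (hx : x ∈ stratum E)
    (h0 : ‖x‖ ≠ 0) : radialMap x ∈ sphStratum E := by
  refine ⟨fun i => ?_, mem_unitSphere.2 ?_⟩
  · rw [radialMap_apply, ← hx i]
    simp [h0]
  · rw [radialMap, norm_smul, norm_inv, norm_norm, inv_mul_cancel₀ h0]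

theorem radialMap_mem_unitSphere {x : Rn n} (h0 : ‖x‖ ≠ 0) : radialMap x ∈ unitSphere n := by
  rw [mem_unitSphere, radialMap, norm_smul, norm_inv, norm_norm, inv_mul_cancel₀ h0]

theorem concentratedOn_radialProj {ρ : SM n} (hρ : NormIntegrable ρ) :
    ConcentratedOn (radialProj ρ) (unitSphere n) := by
  intro B hB hBS
  rw [radialProj_apply_eq_sint hρ hB]
  refine VectorMeasure.integral_eq_zero_of_ae (Filter.Eventually.of_forall fun x => ?_)
  by_cases h0 : ‖x‖ = 0
  · simp [h0]
  · have : radialMap x ∉ B := fun h => hBS h (radialMap_mem_unitSphere h0)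
    simp [this]

theorem concentratedOn_radialProj_sphStratum {ρ : SM n} (hρ : NormIntegrable ρ)
    {E : Finset (Fin n)} (h : ConcentratedOn ρ (stratum E)) :
    ConcentratedOn (radialProj ρ) (sphStratum E) := by
  intro B hB hBS
  rw [radialProj_apply_eq_sint hρ hB]
  refine VectorMeasure.integral_eq_zero_of_ae ?_
  filter_upwards [h.ae (measurableSet_stratum E)] with x hx
  by_cases h0 : ‖x‖ = 0
  · simp [h0]
  · have : radialMap x ∉ B := fun h => hBS h (radialMap_mem_sphStratum hx h0)
    simp [this]

/-! ### Moments -/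

/-- The integral of the monomial with exponents `a` on `E`. -/
def moment (E : Finset (Fin n)) (a : Fin n → ℝ) (ν : SM n) : ℝ := sint ν (mono E a)

theorem moment_zero (E : Finset (Fin n)) (a : Fin n → ℝ) : moment E a (0 : SM n) = 0 := by
  simp [moment, sint]

theorem moment_map {E : Finset (Fin n)} {a : Fin n → ℝ} (ha : Admissible E a) {ν : SM n}
    (hν : NormIntegrable ν) {φ : Rn n → Rn n} (hφ : Measurable φ)
    (h : ∀ x, mono E a (φ x) = mono E a x) : moment E a (ν.map φ) = moment E a ν := by
  have h' : mono E a ∘ φ = mono E a := funext h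
  rw [moment, sint_map hφ (measurable_mono E a) (by rw [h']; exact hν.mono ha), h', moment]

theorem moment_reflMeasure {E : Finset (Fin n)} {a : Fin n → ℝ} (ha : Admissible E a) {ν : SM n}
    (hν : NormIntegrable ν) (F : Finset (Fin n)) :
    moment E a (reflMeasure F ν) = moment E a ν :=
  moment_map ha hν (measurable_reflection F) (mono_reflection E F a)

theorem NormIntegrable.reflMeasure {ν : SM n} (hν : NormIntegrable ν) (F : Finset (Fin n)) :
    NormIntegrable (reflMeasure F ν) :=
  hν.map (measurable_reflection F) fun x => (norm_reflection F x).le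

theorem NormIntegrable.uncAverage {ν : SM n} (hν : NormIntegrable ν) :
    NormIntegrable (uncAverage ν) :=
  (NormIntegrable.sum fun F _ => hν.reflMeasure F).smul _

theorem sint_smul_measure {ν : SM n} (c : ℝ) (f : Rn n → ℝ) : sint (c • ν) f = c * sint ν f :=
  VectorMeasure.integral_smul_vectorMeasure f c

theorem sint_sum_measure {ι : Type*} {s : Finset ι} {ν : ι → SM n} {f : Rn n → ℝ}
    (h : ∀ i ∈ s, (ν i).Integrable f) : sint (∑ i ∈ s, ν i) f = ∑ i ∈ s, sint (ν i) f :=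
  VectorMeasure.integral_finsetSum_vectorMeasure h

theorem moment_uncAverage {E : Finset (Fin n)} {a : Fin n → ℝ} (ha : Admissible E a) {ν : SM n}
    (hν : NormIntegrable ν) : moment E a (uncAverage ν) = moment E a ν := by
  rw [moment, uncAverage, sint_smul_measure,
    sint_sum_measure fun F _ => (hν.reflMeasure F).mono ha]
  have h (F : Finset (Fin n)) : sint (reflMeasure F ν) (mono E a) = moment E a ν :=
    moment_reflMeasure ha hν F
  simp [h]

theorem moment_radialProj {E : Finset (Fin n)} {a : Fin n → ℝ} (ha : Admissible E a) {ρ : SM n}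
    (hρ : NormIntegrable ρ) : moment E a (radialProj ρ) = moment E a ρ := by
  have h : (fun x : Rn n => ‖x‖ * mono E a (radialMap x)) = mono E a :=
    funext (norm_mul_mono_radialMap ha)
  rw [moment, sint_radialProj hρ (measurable_mono E a) (by rw [h]; exact hρ.mono ha), h, moment]

theorem moment_mulConv {E : Finset (Fin n)} {a : Fin n → ℝ} (ha : Admissible E a) {ν μ : SM n}
    (hν : NormIntegrable ν) (hμ : NormIntegrable μ) :
    moment E a (mulConv ν μ) = moment E a ν * moment E a μ := by
  have h : (mono E a ∘ fun p : Rn n × Rn n => hadamard p.1 p.2) =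
      fun z => mono E a z.1 * mono E a z.2 := funext fun z => mono_hadamard E a z.1 z.2
  rw [moment, mulConv, sint_map measurable_hadamard (measurable_mono E a)
    (by rw [h]; exact integrable_prod_mul (hν.mono ha) (hμ.mono ha)), h,
    sint_prod_mul (hν.mono ha) (hμ.mono ha), moment, moment]

theorem moment_sphConv {E : Finset (Fin n)} {a : Fin n → ℝ} (ha : Admissible E a) {ν μ : SM n}
    (hν : NormIntegrable ν) (hμ : NormIntegrable μ) :
    moment E a (sphConv ν μ) = moment E a ν * moment E a μ := by
  rw [sphConv, moment_radialProj ha (hν.mulConv hμ), moment_mulConv ha hν hμ]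

/-! ### Moments along lines of exponents -/

/-- The logarithm of the monomial with exponents `b` on `E`. -/
def logForm (E : Finset (Fin n)) (b : Fin n → ℝ) (x : Rn n) : ℝ := ∑ i ∈ E, b i * Real.log |x i|

/-- The parameters for which the exponents `a + s b` are positive on `E`. -/
def posParams (E : Finset (Fin n)) (a b : Fin n → ℝ) : Set ℝ := {s | ∀ i ∈ E, 0 < a i + s * b i}

theorem isOpen_posParams (E : Finset (Fin n)) (a b : Fin n → ℝ) : IsOpen (posParams E a b) := by
  have h : posParams E a b = ⋂ i ∈ E, {s | 0 < a i + s * b i} := by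
    ext s
    simp [posParams]
  rw [h]
  exact isOpen_biInter_finset fun i _ => isOpen_lt continuous_const (by fun_prop)

theorem convex_posParams (E : Finset (Fin n)) (a b : Fin n → ℝ) : Convex ℝ (posParams E a b) := by
  intro s hs t ht u v hu hv huv i hi
  have h1 := hs i hi
  have h2 := ht i hi
  have h : a i + (u • s + v • t) * b i = u * (a i + s * b i) + v * (a i + t * b i) := by
    simp only [smul_eq_mul]
    linear_combination -(a i) * huv
  rw [h]
  rcases hu.eq_or_lt with rfl | hu
  · have : v = 1 := by linarith
    simpa [this] using h2
  · positivity

theorem mono_add_smul {E : Finset (Fin n)} {a b : Fin n → ℝ} (ha : ∀ i ∈ E, 0 < a i) {s : ℝ}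
    (hs : s ∈ posParams E a b) (x : Rn n) :
    mono E (a + s • b) x = mono E a x * Real.exp (s * logForm E b x) := by
  -- If a coordinate in `E` vanishes, the logarithm carries no information, but the positive
  -- exponents make both monomials zero.
  by_cases h : ∃ i ∈ E, x i = 0
  · rw [(mono_eq_zero_iff (fun i hi => by simpa using hs i hi) x).2 h, (mono_eq_zero_iff ha x).2 h, zero_mul]
  · push Not at h
    rw [logForm, Finset.mul_sum, Real.exp_sum, mono, mono, ← Finset.prod_mul_distrib]
    refine Finset.prod_congr rfl fun i hi => ?_
    have hx : 0 < |x i| := abs_pos.2 (h i hi)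
    rw [Pi.add_apply, Real.rpow_add hx, Real.rpow_def_of_pos hx ((s • b) i)]
    congr 2
    simp only [Pi.smul_apply, smul_eq_mul]
    ring

theorem admissible_add_smul {E : Finset (Fin n)} {a b : Fin n → ℝ} (ha : Admissible E a)
    (hb : ∑ i ∈ E, b i = 0) {s : ℝ} (hs : s ∈ posParams E a b) : Admissible E (a + s • b) := by
  refine ⟨fun i hi => by simpa using hs i hi, ?_⟩
  simp [Finset.sum_add_distrib, ← Finset.mul_sum, ha.2, hb]

/-- The measure with density a monomial. -/
def weighted (E : Finset (Fin n)) (a : Fin n → ℝ) (m : Measure (Rn n)) : Measure (Rn n) :=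
  m.withDensity fun x => ENNReal.ofReal (mono E a x)

theorem integral_weighted (E : Finset (Fin n)) (a : Fin n → ℝ) (m : Measure (Rn n))
    (g : Rn n → ℝ) : ∫ x, g x ∂weighted E a m = ∫ x, mono E a x * g x ∂m :=
  integral_withDensity_ofReal (measurable_mono E a) (mono_nonneg E a) g

theorem integrable_mono {m : Measure (Rn n)} (hm : Integrable (fun x => ‖x‖) m)
    {E : Finset (Fin n)} {a : Fin n → ℝ} (ha : Admissible E a) : Integrable (mono E a) m :=
  hm.mono' (measurable_mono E a).aestronglyMeasurable (Filter.Eventually.of_forall fun x => by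
    rw [Real.norm_of_nonneg (mono_nonneg E a x)]
    exact mono_le_norm ha x)

theorem isFiniteMeasure_weighted {m : Measure (Rn n)} (hm : Integrable (fun x => ‖x‖) m)
    {E : Finset (Fin n)} {a : Fin n → ℝ} (ha : Admissible E a) :
    IsFiniteMeasure (weighted E a m) :=
  isFiniteMeasure_withDensity_of_integrable (integrable_mono hm ha)

/-- Moving the exponents along a line tilts the weighted measure exponentially, so moments on that
line are values of a moment generating function. -/
theorem mgf_weighted {E : Finset (Fin n)} {a b : Fin n → ℝ} (ha : Admissible E a)
    (m : Measure (Rn n)) {s : ℝ} (hs : s ∈ posParams E a b) :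
    ProbabilityTheory.mgf (logForm E b) (weighted E a m) s = ∫ x, mono E (a + s • b) x ∂m := by
  rw [ProbabilityTheory.mgf, integral_weighted]
  simp_rw [mono_add_smul ha.1 hs]

theorem posParams_subset_interior {E : Finset (Fin n)} {a b : Fin n → ℝ} (ha : Admissible E a)
    (hb : ∑ i ∈ E, b i = 0) {m : Measure (Rn n)} (hm : Integrable (fun x => ‖x‖) m) :
    posParams E a b ⊆
      interior (ProbabilityTheory.integrableExpSet (logForm E b) (weighted E a m)) := by
  refine interior_maximal (fun s hs => ?_) (isOpen_posParams E a b)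
  refine (integrable_withDensity_ofReal (measurable_mono E a) (mono_nonneg E a)).2 ?_
  simp_rw [← mono_add_smul ha.1 hs]
  exact integrable_mono hm (admissible_add_smul ha hb hs)

/-- Each Jordan part contributes a moment generating function, which is analytic inside its domain
of finiteness. The bound of admissible monomials by the norm puts every admissible parameter there.
-/
theorem analyticOnNhd_moment_line {E : Finset (Fin n)} {a b : Fin n → ℝ} (ha : Admissible E a)
    (hb : ∑ i ∈ E, b i = 0) {ν : SM n} (hν : NormIntegrable ν) :
    AnalyticOnNhd ℝ (fun s : ℝ => moment E (a + s • b) ν) (posParams E a b) := by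
  have h1 := ProbabilityTheory.analyticOnNhd_mgf.mono
    (posParams_subset_interior ha hb (integrable_posPart hν))
  have h2 := ProbabilityTheory.analyticOnNhd_mgf.mono
    (posParams_subset_interior ha hb (integrable_negPart hν))
  refine (h1.sub h2).congr (isOpen_posParams E a b) fun s hs => ?_
  rw [moment, sint_eq_sub (hν.mono (admissible_add_smul ha hb hs)), Pi.sub_apply,
    mgf_weighted ha _ hs, mgf_weighted ha _ hs]

/-- The moments of two measures cannot have a vanishing product unless those of one of the
measures vanish identically. -/
theorem moment_eq_zero_or_of_mul_eq_zero {E : Finset (Fin n)} {ν μ : SM n}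
    (hν : NormIntegrable ν) (hμ : NormIntegrable μ)
    (h : ∀ a, Admissible E a → moment E a ν * moment E a μ = 0) :
    (∀ a, Admissible E a → moment E a ν = 0) ∨ ∀ a, Admissible E a → moment E a μ = 0 := by
  by_contra! hc
  obtain ⟨⟨a, ha, hνa⟩, c, hc, hμc⟩ := hc
  -- Work on the line through the two exponents with non-zero moments: `s = 0` gives `a` and `s = 1`
  -- gives `c`.
  have hb : ∑ i ∈ E, (c - a) i = 0 := by
    simp [Finset.sum_sub_distrib, ha.2, hc.2]
  have h0 : (0 : ℝ) ∈ posParams E a (c - a) := fun i hi => by simpa using ha.1 i hi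
  have h1 : (1 : ℝ) ∈ posParams E a (c - a) := fun i hi => by simpa using hc.1 i hi
  rcases (analyticOnNhd_moment_line ha hb hν).eq_zero_or_eq_zero_of_mul_eq_zero
    (analyticOnNhd_moment_line ha hb hμ) (fun s hs => h _ (admissible_add_smul ha hb hs))
    (convex_posParams E a (c - a)).isPreconnected with H | H
  · exact hνa (by simpa using H 0 h0)
  · exact hμc (by simpa using H 1 h1)

/-! ### Uniqueness -/

/-- Equal moments give equal characteristic functions of the weighted logarithms. -/
theorem complexMGF_weighted_eq {E : Finset (Fin n)} {a b : Fin n → ℝ} (ha : Admissible E a)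
    (hb : ∑ i ∈ E, b i = 0) {p q : Measure (Rn n)} (hp : Integrable (fun x => ‖x‖) p)
    (hq : Integrable (fun x => ‖x‖) q)
    (h : ∀ c, Admissible E c → ∫ x, mono E c x ∂p = ∫ x, mono E c x ∂q) :
    ProbabilityTheory.complexMGF (logForm E b) (weighted E a p) Complex.I =
      ProbabilityTheory.complexMGF (logForm E b) (weighted E a q) Complex.I := by
  have h0 : (0 : ℝ) ∈ posParams E a b := fun i hi => by simpa using ha.1 i hi
  have hP : AnalyticOnNhd ℂ (ProbabilityTheory.complexMGF (logForm E b) (weighted E a p))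
      {z | z.re ∈ posParams E a b} :=
    ProbabilityTheory.analyticOnNhd_complexMGF.mono
      fun z hz => posParams_subset_interior ha hb hp hz
  have hQ : AnalyticOnNhd ℂ (ProbabilityTheory.complexMGF (logForm E b) (weighted E a q))
      {z | z.re ∈ posParams E a b} :=
    ProbabilityTheory.analyticOnNhd_complexMGF.mono
      fun z hz => posParams_subset_interior ha hb hq hz
  -- Both functions are analytic on the strip over the interval of admissible parameters and agree
  -- at real points accumulating at `0`. The strip is convex and contains `I`, whose real part is
  -- `0`.
  refine AnalyticOnNhd.eqOn_of_preconnected_of_frequently_eq hP hQ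
    ((convex_posParams E a b).linear_preimage Complex.reLm).isPreconnected
    (z₀ := 0) (by simpa using h0) ?_ (by simpa using h0)
  have hev : ∀ᶠ s : ℝ in nhdsWithin 0 {0}ᶜ,
      ProbabilityTheory.complexMGF (logForm E b) (weighted E a p) (s : ℂ) =
        ProbabilityTheory.complexMGF (logForm E b) (weighted E a q) (s : ℂ) := by
    refine nhdsWithin_le_nhds ?_
    filter_upwards [(isOpen_posParams E a b).mem_nhds h0] with s hs
    rw [ProbabilityTheory.complexMGF_ofReal, ProbabilityTheory.complexMGF_ofReal,
      mgf_weighted ha _ hs, mgf_weighted ha _ hs, h _ (admissible_add_smul ha hb hs)]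
  have ht : Filter.Tendsto (fun s : ℝ => (s : ℂ)) (nhdsWithin 0 {0}ᶜ) (nhdsWithin 0 {0}ᶜ) := by
    refine tendsto_nhdsWithin_iff.2 ⟨?_, ?_⟩
    · exact (Complex.continuous_ofReal.tendsto' 0 0 (by simp)).mono_left nhdsWithin_le_nhds
    · filter_upwards [self_mem_nhdsWithin] with s hs
      simpa using hs
  exact ht.frequently hev.frequently

/-- Logarithms of the absolute values of the coordinates in `E`, centred. -/
def centredLog (E : Finset (Fin n)) (x : Rn n) : Rn n :=
  WithLp.toLp 2 fun i =>
    if i ∈ E then Real.log |x i| - (∑ j ∈ E, Real.log |x j|) / E.card else 0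

/-- The left inverse of `centredLog E` on the non-negative part of `B_E`. -/
def expDirection (E : Finset (Fin n)) (y : Rn n) : Rn n :=
  radialMap (WithLp.toLp 2 fun i => if i ∈ E then Real.exp (y i) else 0)

theorem measurable_centredLog (E : Finset (Fin n)) : Measurable (centredLog E) := by
  unfold centredLog
  refine (WithLp.measurable_toLp 2 _).comp (measurable_pi_lambda _ fun i => ?_)
  split_ifs <;> fun_prop

theorem measurable_expDirection (E : Finset (Fin n)) : Measurable (expDirection E) := by
  unfold expDirection
  refine measurable_radialMap.comp
    ((WithLp.measurable_toLp 2 _).comp (measurable_pi_lambda _ fun i => ?_))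
  split_ifs <;> fun_prop

/-- Centring costs only a common positive factor, which normalization to the sphere restores. The
signs are lost, hence `absVec`. -/
theorem expDirection_centredLog {E : Finset (Fin n)} {x : Rn n} (hx : x ∈ sphStratum E) :
    expDirection E (centredLog E x) = absVec x := by
  set c := (∑ j ∈ E, Real.log |x j|) / E.card with hc
  have h : (WithLp.toLp 2 fun i => if i ∈ E then Real.exp (centredLog E x i) else 0) =
      (Real.exp (-c)) • absVec x := by
    ext i
    by_cases hi : i ∈ E
    · have h0 : 0 < |x i| := abs_pos.2 ((hx.1 i).2 hi)
      simp only [hi, if_true, centredLog, ← hc, PiLp.smul_apply, absVec_apply, smul_eq_mul]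
      rw [sub_eq_add_neg, Real.exp_add, Real.exp_log h0, mul_comm]
    · have h0 : x i = 0 := by
        by_contra h0
        exact hi ((hx.1 i).1 h0)
      simp [hi, h0]
  have hn : ‖absVec x‖ = 1 := by
    rw [← mem_unitSphere.1 hx.2]
    exact norm_eq_of_abs_eq fun i => by simp
  rw [expDirection, h, radialMap, norm_smul, hn, smul_smul, mul_one,
    Real.norm_of_nonneg (Real.exp_pos _).le, inv_mul_cancel₀ (Real.exp_pos _).ne', one_smul]

/-- Centring is self-adjoint, so it moves from the logarithms to `t`. The resulting coefficients sum
to zero on `E`, as needed for a direction that preserves the sum of the exponents. -/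
theorem inner_centredLog {E : Finset (Fin n)} (x t : Rn n) :
    inner ℝ (centredLog E x) t =
      logForm E (fun i => t i - (∑ j ∈ E, t j) / E.card) x := by
  have h : inner ℝ (centredLog E x) t =
      ∑ i ∈ E, (Real.log |x i| - (∑ j ∈ E, Real.log |x j|) / E.card) * t i := by
    rw [PiLp.inner_apply, ← Finset.sum_subset (Finset.subset_univ E)]
    · refine Finset.sum_congr rfl fun i hi => ?_
      simp [centredLog, hi, mul_comm]
    · intro i _ hi
      simp [centredLog, hi]
  rw [h, logForm]
  simp only [sub_mul, Finset.sum_sub_distrib, ← Finset.mul_sum]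
  rw [Finset.sum_congr rfl fun i _ => mul_comm (Real.log |x i|) (t i)]
  ring

/-- The constant exponents `1 / |E|`. -/
def uniformExp (E : Finset (Fin n)) : Fin n → ℝ := fun _ => (E.card : ℝ)⁻¹

theorem admissible_uniformExp {E : Finset (Fin n)} (hE : E.Nonempty) :
    Admissible E (uniformExp E) := by
  have h : (0 : ℝ) < E.card := by exact_mod_cast hE.card_pos
  exact ⟨fun i _ => inv_pos.2 h, by simp [uniformExp, h.ne']⟩

/-- The characteristic function of the image at `t` is a complex moment generating function at `I`,
which the moments determine. -/
theorem map_centredLog_eq {E : Finset (Fin n)} (hE : E.Nonempty) {p q : Measure (Rn n)}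
    (hp : Integrable (fun x => ‖x‖) p) (hq : Integrable (fun x => ‖x‖) q)
    (h : ∀ c, Admissible E c → ∫ x, mono E c x ∂p = ∫ x, mono E c x ∂q) :
    (weighted E (uniformExp E) p).map (centredLog E) =
      (weighted E (uniformExp E) q).map (centredLog E) := by
  have ha := admissible_uniformExp hE
  have := isFiniteMeasure_weighted hp ha
  have := isFiniteMeasure_weighted hq ha
  have key (m : Measure (Rn n)) (t : Rn n) :
      charFun ((weighted E (uniformExp E) m).map (centredLog E)) t =
        ProbabilityTheory.complexMGF (logForm E fun i => t i - (∑ j ∈ E, t j) / E.card)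
          (weighted E (uniformExp E) m) Complex.I := by
    rw [charFun_apply, integral_map (measurable_centredLog E).aemeasurable
      (by fun_prop), ProbabilityTheory.complexMGF]
    refine integral_congr_ae (Filter.Eventually.of_forall fun x => ?_)
    simp only [inner_centredLog, mul_comm]
  refine Measure.ext_of_charFun (funext fun t => ?_)
  rw [key, key]
  refine complexMGF_weighted_eq ha ?_ hp hq h
  have h0 : (E.card : ℝ) ≠ 0 := by exact_mod_cast hE.card_pos.ne'
  rw [Finset.sum_sub_distrib, Finset.sum_const, nsmul_eq_mul, mul_div_cancel₀ _ h0, sub_self]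

/-- On `B_E` a function of the absolute values factors through `centredLog E`. The weight is
non-zero there and can be divided out, so the integral depends only on the image measure already
identified. -/
theorem integral_eq_of_moments_eq {E : Finset (Fin n)} (hE : E.Nonempty) {p q : Measure (Rn n)}
    (hp : Integrable (fun x => ‖x‖) p) (hq : Integrable (fun x => ‖x‖) q)
    (hpE : ∀ᵐ x ∂p, x ∈ sphStratum E) (hqE : ∀ᵐ x ∂q, x ∈ sphStratum E)
    (h : ∀ c, Admissible E c → ∫ x, mono E c x ∂p = ∫ x, mono E c x ∂q)
    {g : Rn n → ℝ} (hg : Measurable g) (hg' : ∀ x, g (absVec x) = g x) :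
    ∫ x, g x ∂p = ∫ x, g x ∂q := by
  set u := uniformExp E
  have ha : Admissible E u := admissible_uniformExp hE
  have key (m : Measure (Rn n)) (hm : ∀ᵐ x ∂m, x ∈ sphStratum E) :
      ∫ x, g x ∂m = ∫ y, g (expDirection E y) / mono E u (expDirection E y)
        ∂(weighted E u m).map (centredLog E) := by
    rw [integral_map (measurable_centredLog E).aemeasurable, integral_weighted]
    · refine integral_congr_ae ?_
      filter_upwards [hm] with x hx
      have h0 : mono E u x ≠ 0 := by
        rw [Ne, mono_eq_zero_iff ha.1]
        rintro ⟨i, hi, hi0⟩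
        exact (hx.1 i).2 hi hi0
      rw [expDirection_centredLog hx, hg', mono_absVec]
      field_simp
    · exact ((hg.comp (measurable_expDirection E)).div
        ((measurable_mono E u).comp (measurable_expDirection E))).aestronglyMeasurable
  rw [key p hpE, key q hqE, map_centredLog_eq hE hp hq h]

/-! ### Unconditional measures -/

theorem reflection_reflection (E F : Finset (Fin n)) (x : Rn n) :
    reflection E (reflection F x) = reflection (symmDiff E F) x := by
  ext i
  by_cases hE : i ∈ E <;> by_cases hF : i ∈ F <;> simp [hE, hF, Finset.mem_symmDiff]

theorem absVec_eq_reflection (x : Rn n) :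
    absVec x = reflection (Finset.univ.filter fun i => x i < 0) x := by
  ext i
  by_cases h : x i < 0
  · simp [h, abs_of_neg h]
  · simp [h, abs_of_nonneg (not_lt.1 h)]

theorem sum_symmDiff {M : Type*} [AddCommMonoid M] (F : Finset (Fin n))
    (f : Finset (Fin n) → M) : ∑ E, f (symmDiff E F) = ∑ E, f E :=
  Equiv.sum_comp (Function.Involutive.toPerm (fun E => symmDiff E F)
    fun E => symmDiff_symmDiff_cancel_right F E) f

/-- `absVec x` is a reflection of `x`, and reflections form a group under symmetric difference, so
the sum is only reindexed. -/
theorem sum_comp_reflection_absVec (g : Rn n → ℝ) (x : Rn n) :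
    ∑ E, g (reflection E (absVec x)) = ∑ E, g (reflection E x) := by
  simp only [absVec_eq_reflection x, reflection_reflection]
  exact sum_symmDiff _ fun E => g (reflection E x)

theorem reflMeasure_apply (E : Finset (Fin n)) (ν : SM n) {B : Set (Rn n)}
    (hB : MeasurableSet B) : reflMeasure E ν B = ν (reflection E ⁻¹' B) :=
  VectorMeasure.map_apply _ (measurable_reflection E) hB

theorem uncAverage_apply (ν : SM n) {B : Set (Rn n)} (hB : MeasurableSet B) :
    uncAverage ν B = ((2 : ℝ) ^ n)⁻¹ * ∑ E, ν (reflection E ⁻¹' B) := by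
  simp [uncAverage, _root_.sum_apply, reflMeasure_apply _ _ hB]

theorem isUnconditional_uncAverage (ν : SM n) : IsUnconditional (uncAverage ν) := by
  intro F
  ext B hB
  rw [reflMeasure_apply F _ hB, uncAverage_apply _ (measurable_reflection F hB),
    uncAverage_apply _ hB, ← sum_symmDiff F]
  congr 1
  refine Finset.sum_congr rfl fun E _ => ?_
  rw [← Set.preimage_comp]
  congr 2
  ext x : 1
  rw [Function.comp_apply, reflection_reflection]
  congr 1
  rw [symmDiff_comm E F, symmDiff_symmDiff_cancel_left]

theorem reflection_mem_stratum {E F : Finset (Fin n)} {x : Rn n} :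
    reflection F x ∈ stratum E ↔ x ∈ stratum E := by
  refine forall_congr' fun i => ?_
  rw [← abs_ne_zero, abs_reflection_apply, abs_ne_zero]

theorem reflection_mem_sphStratum {E F : Finset (Fin n)} {x : Rn n} :
    reflection F x ∈ sphStratum E ↔ x ∈ sphStratum E :=
  and_congr reflection_mem_stratum (by rw [mem_unitSphere, mem_unitSphere, norm_reflection])

theorem reflection_mem_unitSphere {F : Finset (Fin n)} {x : Rn n} :
    reflection F x ∈ unitSphere n ↔ x ∈ unitSphere n := by
  rw [mem_unitSphere, mem_unitSphere, norm_reflection]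

theorem ConcentratedOn.uncAverage {ν : SM n} {A : Set (Rn n)} (h : ConcentratedOn ν A)
    (hA : ∀ F x, reflection F x ∈ A ↔ x ∈ A) : ConcentratedOn (uncAverage ν) A := by
  intro B hB hBA
  rw [uncAverage_apply _ hB, Finset.sum_eq_zero, mul_zero]
  intro E _
  exact h _ (measurable_reflection E hB) fun x hx hxA => hBA hx ((hA E x).2 hxA)

theorem coordPart_apply (E : Finset (Fin n)) (ν : SM n) {B : Set (Rn n)} (hB : MeasurableSet B) :
    coordPart E ν B = ν (B ∩ stratum E) :=
  VectorMeasure.restrict_apply _ (measurableSet_stratum E) hB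

theorem IsUnconditional.coordPart {ν : SM n} (h : IsUnconditional ν) (E : Finset (Fin n)) :
    IsUnconditional (coordPart E ν) := by
  intro F
  ext B hB
  rw [reflMeasure_apply F _ hB, coordPart_apply _ _ (measurable_reflection F hB),
    coordPart_apply _ _ hB]
  conv_rhs => rw [← h F, reflMeasure_apply F _ (hB.inter (measurableSet_stratum E))]
  congr 1
  ext x
  simp [reflection_mem_stratum]

theorem ConcentratedOn.coordPart {ν : SM n} (h : ConcentratedOn ν (unitSphere n))
    (E : Finset (Fin n)) : ConcentratedOn (coordPart E ν) (sphStratum E) := by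
  intro B hB hBA
  rw [coordPart_apply E ν hB]
  exact h _ (hB.inter (measurableSet_stratum E)) fun x hx hxS => hBA hx.1 ⟨hx.2, hxS⟩

theorem sphStratum_subset (E : Finset (Fin n)) : sphStratum E ⊆ unitSphere n :=
  Set.inter_subset_right

theorem ae_posPart {ν : SM n} {A : Set (Rn n)} (h : ∀ᵐ x ∂ν.variation, x ∈ A) :
    ∀ᵐ x ∂ν.toJordanDecomposition.posPart, x ∈ A := by
  refine ae_mono ?_ h
  rw [← SignedMeasure.totalVariation_eq_variation]
  exact Measure.le_add_right le_rfl

theorem ae_negPart {ν : SM n} {A : Set (Rn n)} (h : ∀ᵐ x ∂ν.variation, x ∈ A) :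
    ∀ᵐ x ∂ν.toJordanDecomposition.negPart, x ∈ A := by
  refine ae_mono ?_ h
  rw [← SignedMeasure.totalVariation_eq_variation]
  exact Measure.le_add_left le_rfl

/-- An unconditional measure on `B_E` is determined by its moments. -/
theorem eq_zero_of_moment_eq_zero {E : Finset (Fin n)} (hE : E.Nonempty) {τ : SM n}
    (hτ : ConcentratedOn τ (sphStratum E)) (hu : IsUnconditional τ)
    (h : ∀ a, Admissible E a → moment E a τ = 0) : τ = 0 := by
  have hi : NormIntegrable τ := (hτ.mono (sphStratum_subset E)).normIntegrable
  have hae := hτ.ae (measurableSet_sphStratum E)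
  ext B hB
  rw [_root_.zero_apply]
  set g : Rn n → ℝ := B.indicator fun _ => 1
  have hg : Measurable g := measurable_const.indicator hB
  have hgF (F : Finset (Fin n)) : Measurable fun x => g (reflection F x) :=
    hg.comp (measurable_reflection F)
  have hgi (F : Finset (Fin n)) : τ.Integrable fun x => g (reflection F x) :=
    integrable_of_bounded τ (hgF F) 1 fun x => indicator_le_one B _
  have h1 (F : Finset (Fin n)) : sint τ (fun x => g (reflection F x)) = τ B := by
    rw [← sint_indicator_one τ hB]
    conv_rhs => rw [← hu F]
    exact (sint_map (measurable_reflection F) hg (hgi F)).symm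
  -- The indicator summed over all reflections integrates to `2^n τ(B)` by unconditionality, and to
  -- zero because it depends only on absolute values.
  have h2 : sint τ (fun x => ∑ F, g (reflection F x)) = (2 : ℝ) ^ n * τ B := by
    rw [sint, VectorMeasure.integral_finsetSum _ fun F _ => hgi F]
    have h3 (F : Finset (Fin n)) : ∫ᵛ x, g (reflection F x) ∂<•τ = τ B := h1 F
    simp [h3]
  have h4 : sint τ (fun x => ∑ F, g (reflection F x)) = 0 := by
    rw [sint_eq_sub (VectorMeasure.Integrable.fun_finsetSum _ fun F _ => hgi F), sub_eq_zero]
    refine integral_eq_of_moments_eq hE (integrable_posPart hi) (integrable_negPart hi)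
      (ae_posPart hae) (ae_negPart hae) (fun c hc => ?_)
      (Finset.measurable_fun_sum _ fun F _ => hgF F) (sum_comp_reflection_absVec g)
    rw [← sub_eq_zero, ← sint_eq_sub (hi.mono hc)]
    exact h c hc
  rw [h4] at h2
  simpa using h2.symm

theorem mono_eq_zero_of_mem_stratum {E G : Finset (Fin n)} {a : Fin n → ℝ}
    (ha : ∀ i ∈ E, 0 < a i) {x : Rn n} (hx : x ∈ stratum G) (hEG : ¬ E ⊆ G) : mono E a x = 0 := by
  obtain ⟨i, hi, hiG⟩ := Finset.not_subset.1 hEG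
  refine (mono_eq_zero_iff ha x).2 ⟨i, hi, ?_⟩
  by_contra h0
  exact hiG ((hx i).1 h0)

/-- The set of non-zero coordinates. -/
def supp (x : Rn n) : Finset (Fin n) := Finset.univ.filter fun i => x i ≠ 0

theorem mem_stratum_iff {E : Finset (Fin n)} {x : Rn n} : x ∈ stratum E ↔ supp x = E := by
  rw [Finset.ext_iff]
  exact forall_congr' fun i => by simp [supp]

theorem NormIntegrable.coordPart {ν : SM n} (h : NormIntegrable ν) (E : Finset (Fin n)) :
    NormIntegrable (coordPart E ν) :=
  VectorMeasure.Integrable.restrict h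

theorem sum_coordPart (ν : SM n) : ∑ E, coordPart E ν = ν := by
  ext B hB
  have hU : B = ⋃ E ∈ (Finset.univ : Finset (Finset (Fin n))), B ∩ stratum E := by
    ext x
    simp [mem_stratum_iff]
  conv_rhs => rw [hU]
  rw [VectorMeasure.of_biUnion_finset]
  · simp [_root_.sum_apply, coordPart_apply _ _ hB]
  · intro E _ F _ hEF
    refine Set.disjoint_left.2 fun x hx hx' => hEF ?_
    rw [← mem_stratum_iff.1 hx.2, ← mem_stratum_iff.1 hx'.2]
  · exact fun E _ => hB.inter (measurableSet_stratum E)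

/-- The monomial vanishes on every stratum not containing `E`, and the strata strictly above `E` are
not charged. -/
theorem moment_eq_moment_coordPart {E : Finset (Fin n)} {a : Fin n → ℝ} (ha : Admissible E a)
    {ν : SM n} (hν : NormIntegrable ν)
    (h : ∀ G, E ⊆ G → G ≠ E → coordPart G ν = 0) :
    moment E a ν = moment E a (coordPart E ν) := by
  conv_lhs => rw [← sum_coordPart ν]
  rw [moment, sint_sum_measure fun G _ => (hν.coordPart G).mono ha]
  refine Finset.sum_eq_single E (fun G _ hG => ?_) (by simp)
  by_cases hEG : E ⊆ G
  · rw [h G hEG hG]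
    exact moment_zero E a
  · rw [coordPart, sint_restrict _ (measurableSet_stratum G)]
    refine VectorMeasure.integral_eq_zero_of_ae (Filter.Eventually.of_forall fun x => ?_)
    by_cases hx : x ∈ stratum G
    · simp [hx, mono_eq_zero_of_mem_stratum ha.1 hx hEG]
    · simp [hx]

theorem coordPart_empty {ν : SM n} (h : ConcentratedOn ν (unitSphere n)) :
    coordPart ∅ ν = 0 := by
  ext B hB
  rw [coordPart_apply _ _ hB, _root_.zero_apply]
  refine h _ (hB.inter (measurableSet_stratum ∅)) fun x hx hxS => ?_
  have h0 : x = 0 := by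
    ext i
    by_contra h0
    simpa using (hx.2 i).1 h0
  rw [mem_unitSphere, h0, norm_zero] at hxS
  exact zero_ne_one hxS

/-- An unconditional measure on the sphere is determined by its moments. -/
theorem eq_zero_of_forall_moment_eq_zero {ρ : SM n} (hρ : ConcentratedOn ρ (unitSphere n))
    (hu : IsUnconditional ρ)
    (h : ∀ E : Finset (Fin n), E.Nonempty → ∀ a, Admissible E a → moment E a ρ = 0) : ρ = 0 := by
  by_contra h0
  obtain ⟨E, hE⟩ : ∃ E, coordPart E ρ ≠ 0 := by
    by_contra! hc
    exact h0 (by rw [← sum_coordPart ρ]; exact Finset.sum_eq_zero fun E _ => hc E)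
  -- For an inclusion-maximal charged stratum, moments of type `M` see only the part on `A_M`, which
  -- must then vanish.
  obtain ⟨M, -, hM⟩ := Set.Finite.exists_le_maximal
    (Set.toFinite {E | coordPart E ρ ≠ 0}) hE
  have hne : M.Nonempty := by
    rw [Finset.nonempty_iff_ne_empty]
    rintro rfl
    exact hM.prop (coordPart_empty hρ)
  refine hM.prop (eq_zero_of_moment_eq_zero hne (hρ.coordPart M) (hu.coordPart M) fun a ha => ?_)
  rw [← moment_eq_moment_coordPart ha hρ.normIntegrable, h M hne a ha]
  intro G hMG hGM
  by_contra hG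
  exact hGM (hM.eq_of_ge hG hMG)

/-! ### Reflections and the spherical convolution -/

theorem radialMap_reflection (F : Finset (Fin n)) (x : Rn n) :
    radialMap (reflection F x) = reflection F (radialMap x) := by
  ext i
  rw [radialMap_apply, norm_reflection]
  by_cases hi : i ∈ F <;> simp [hi]

theorem reflMeasure_radialProj {ρ : SM n} (hρ : NormIntegrable ρ) (F : Finset (Fin n)) :
    reflMeasure F (radialProj ρ) = radialProj (reflMeasure F ρ) := by
  ext B hB
  have hg : Measurable fun x : Rn n => ‖x‖ * B.indicator (fun _ => (1 : ℝ)) (radialMap x) :=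
    measurable_norm.mul ((measurable_const.indicator hB).comp measurable_radialMap)
  have h : (fun x : Rn n => ‖x‖ * B.indicator (fun _ => (1 : ℝ)) (radialMap x)) ∘ reflection F =
      fun x => ‖x‖ * (reflection F ⁻¹' B).indicator (fun _ => (1 : ℝ)) (radialMap x) := by
    ext x
    rw [Function.comp_apply, norm_reflection, radialMap_reflection]
    rfl
  rw [reflMeasure_apply F _ hB, radialProj_apply_eq_sint hρ (measurable_reflection F hB),
    radialProj_apply_eq_sint (hρ.reflMeasure F) hB, reflMeasure,
    sint_map (measurable_reflection F) hg, h]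
  rw [h]
  exact hρ.norm_mul ((measurable_const.indicator (measurable_reflection F hB)).comp
    measurable_radialMap) fun x => indicator_le_one _ _

/-- A sign change of the product can be absorbed by the second factor. Hence `ν ⊛ μ` is
unconditional once `μ` is, whatever `ν`. -/
theorem reflMeasure_mulConv (ν μ : SM n) (F : Finset (Fin n)) :
    reflMeasure F (mulConv ν μ) = mulConv ν (reflMeasure F μ) := by
  have hm : Measurable (Prod.map id (reflection F) : Rn n × Rn n → Rn n × Rn n) :=
    measurable_id.prodMap (measurable_reflection F)
  have hp : ν.prod (reflMeasure F μ) (ContinuousLinearMap.lsmul ℝ ℝ) =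
      (ν.prod μ (ContinuousLinearMap.lsmul ℝ ℝ)).map (Prod.map id (reflection F)) := by
    refine VectorMeasure.prod_eq_of_forall_apply_prod fun s t hs ht => ?_
    rw [VectorMeasure.map_apply _ hm (hs.prod ht), Set.preimage_prod_map_prod,
      VectorMeasure.prod_apply, Set.preimage_id, reflMeasure_apply F _ ht]
  ext B hB
  rw [reflMeasure_apply F _ hB, mulConv, mulConv, hp,
    VectorMeasure.map_apply _ measurable_hadamard (measurable_reflection F hB),
    VectorMeasure.map_apply _ measurable_hadamard hB,
    VectorMeasure.map_apply _ hm (measurable_hadamard hB), ← Set.preimage_comp,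
    ← Set.preimage_comp]
  congr 2
  ext z i
  by_cases hi : i ∈ F <;> simp [hi]

theorem isUnconditional_sphConv {ν μ : SM n} (hν : NormIntegrable ν) (hμ : NormIntegrable μ)
    (hu : IsUnconditional μ) : IsUnconditional (sphConv ν μ) := by
  intro F
  rw [sphConv, reflMeasure_radialProj (hν.mulConv hμ), reflMeasure_mulConv, hu F]

theorem NormIntegrable.projMeasure {ν : SM n} (hν : NormIntegrable ν) (E : Finset (Fin n)) :
    NormIntegrable (projMeasure E ν) :=
  hν.map (measurable_coordProj E) (norm_coordProj_le E)

theorem isUnconditional_sphProj {ν : SM n} (hν : NormIntegrable ν) (hu : IsUnconditional ν)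
    (E : Finset (Fin n)) : IsUnconditional (sphProj E ν) := by
  intro F
  rw [sphProj, reflMeasure_radialProj (hν.projMeasure E)]
  congr 1
  ext B hB
  rw [reflMeasure_apply F _ hB, projMeasure,
    VectorMeasure.map_apply _ (measurable_coordProj E) (measurable_reflection F hB),
    VectorMeasure.map_apply _ (measurable_coordProj E) hB]
  conv_rhs => rw [← hu F, reflMeasure_apply F _ (measurable_coordProj E hB)]
  rw [← Set.preimage_comp, ← Set.preimage_comp]
  congr 2
  ext x i
  by_cases hi : i ∈ F <;> by_cases hE : i ∈ E <;> simp [hi, hE]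

theorem norm_mul_indicator_mono_coordProj {E : Finset (Fin n)} {a : Fin n → ℝ}
    (ha : Admissible E a) (x : Rn n) :
    ‖coordProj E x‖ * (stratum E).indicator (mono E a) (radialMap (coordProj E x)) =
      mono E a x := by
  have h := norm_mul_mono_radialMap ha (coordProj E x)
  rw [mono_coordProj] at h
  by_cases hm : radialMap (coordProj E x) ∈ stratum E
  · rw [Set.indicator_of_mem hm, h]
  · rw [Set.indicator_of_notMem hm, mul_zero]
    symm
    by_contra h0
    have h1 : ‖coordProj E x‖ ≠ 0 := fun h2 => h0 (by rw [← h, h2, zero_mul])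
    refine hm (radialMap_mem_sphStratum (fun i => ?_) h1).1
    have h2 := mt (mono_eq_zero_iff ha.1 x).2 h0
    push Not at h2
    rw [coordProj_apply]
    by_cases hi : i ∈ E
    · simp [hi, h2 i hi]
    · simp [hi]

/-- The monomial depends only on the coordinates in `E`, is homogeneous of degree one, and vanishes
when one of these coordinates is zero. So neither the projection, nor the normalization, nor the
restriction to `A_E` affects the integral. -/
theorem moment_coordPart_sphProj {E : Finset (Fin n)} {a : Fin n → ℝ} (ha : Admissible E a)
    {ν : SM n} (hν : NormIntegrable ν) :
    moment E a (coordPart E (sphProj E ν)) = moment E a ν := by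
  have hg : Measurable ((stratum E).indicator (mono E a)) :=
    (measurable_mono E a).indicator (measurableSet_stratum E)
  have hg' : Measurable fun x => ‖x‖ * (stratum E).indicator (mono E a) (radialMap x) :=
    measurable_norm.mul (hg.comp measurable_radialMap)
  have hle (x : Rn n) : |‖x‖ * (stratum E).indicator (mono E a) (radialMap x)| ≤ ‖x‖ := by
    have h0 : 0 ≤ (stratum E).indicator (mono E a) (radialMap x) :=
      Set.indicator_nonneg (fun y _ => mono_nonneg E a y) _
    rw [abs_of_nonneg (mul_nonneg (norm_nonneg x) h0)]
    refine (mul_le_mul_of_nonneg_left (Set.indicator_le_self' (fun y _ => mono_nonneg E a y) _)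
      (norm_nonneg x)).trans ?_
    rw [norm_mul_mono_radialMap ha]
    exact mono_le_norm ha x
  have h : (fun x => ‖x‖ * (stratum E).indicator (mono E a) (radialMap x)) ∘ coordProj E =
      mono E a := funext (norm_mul_indicator_mono_coordProj ha)
  rw [moment, coordPart, sint_restrict _ (measurableSet_stratum E), sphProj,
    sint_radialProj (hν.projMeasure E) hg ((hν.projMeasure E).of_le hg' hle), projMeasure,
    sint_map (measurable_coordProj E) hg' (by rw [h]; exact hν.mono ha), h, moment]

/-! ### Unconditional measures with prescribed vanishing moments -/

/-- The point with coordinates `2` on `H`, `1` on `E \ H` and `0` outside `E`. -/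
def cubePoint (E H : Finset (Fin n)) : Rn n :=
  WithLp.toLp 2 fun i => if i ∈ E then (if i ∈ H then 2 else 1) else 0

/-- The product of the measures `δ₁ - δ₂` on the coordinates in `E`. -/
def cubeMeasure (E : Finset (Fin n)) : SM n :=
  ∑ H ∈ E.powerset, (-1 : ℝ) ^ H.card • VectorMeasure.dirac (cubePoint E H) (1 : ℝ)

theorem cubePoint_mem_stratum (E H : Finset (Fin n)) : cubePoint E H ∈ stratum E := by
  intro i
  by_cases hi : i ∈ E
  · by_cases hH : i ∈ H <;> simp [cubePoint, hi, hH]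
  · simp [cubePoint, hi]

theorem normIntegrable_dirac (x : Rn n) : NormIntegrable (VectorMeasure.dirac x (1 : ℝ)) := by
  rw [NormIntegrable, VectorMeasure.Integrable, VectorMeasure.variation_dirac]
  exact Integrable.smul_measure (integrable_dirac (by simp)) (by simp)

theorem normIntegrable_cubeMeasure (E : Finset (Fin n)) : NormIntegrable (cubeMeasure E) :=
  NormIntegrable.sum fun _ _ => (normIntegrable_dirac _).smul _

theorem concentratedOn_cubeMeasure (E : Finset (Fin n)) :
    ConcentratedOn (cubeMeasure E) (stratum E) := by
  intro B hB hBE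
  rw [cubeMeasure, _root_.sum_apply]
  refine Finset.sum_eq_zero fun H _ => ?_
  have h : cubePoint E H ∉ B := fun h => hBE h (cubePoint_mem_stratum E H)
  simp [VectorMeasure.dirac_apply_of_notMem, hB, h]

theorem mono_cubePoint {E G H : Finset (Fin n)} (hG : G ⊆ E) (a : Fin n → ℝ) :
    mono G a (cubePoint E H) = ∏ i ∈ H, if i ∈ G then (2 : ℝ) ^ a i else 1 := by
  rw [Finset.prod_ite_mem, Finset.inter_comm, ← Finset.prod_ite_mem]
  refine Finset.prod_congr rfl fun i hi => ?_
  by_cases hH : i ∈ H <;> simp [cubePoint, hG hi, hH]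

/-- The alternating sum over `H` factors over the coordinates: those in `G` contribute `1 - 2 ^ a
i`, the others `1 - 1`. -/
theorem moment_cubeMeasure {E G : Finset (Fin n)} {a : Fin n → ℝ} (ha : Admissible G a)
    (hG : G ⊆ E) :
    moment G a (cubeMeasure E) = ∏ i ∈ E, (1 - if i ∈ G then (2 : ℝ) ^ a i else 1) := by
  rw [moment, cubeMeasure,
    sint_sum_measure fun H _ => ((normIntegrable_dirac _).smul _).mono ha]
  simp_rw [sub_eq_add_neg]
  rw [Finset.prod_one_add]
  refine Finset.sum_congr rfl fun H _ => ?_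
  rw [sint_smul_measure, Finset.prod_neg, ← mono_cubePoint hG a]
  congr 1
  simp [sint]

/-- If `G` is a proper subset of `E`, a factor `1 - 1` occurs; if `G` is not contained in `E`, the
monomial vanishes on `A_E`. -/
theorem moment_cubeMeasure_of_ne {E G : Finset (Fin n)} {a : Fin n → ℝ} (ha : Admissible G a)
    (hne : G ≠ E) : moment G a (cubeMeasure E) = 0 := by
  by_cases hG : G ⊆ E
  · rw [moment_cubeMeasure ha hG]
    obtain ⟨i, hi, hiG⟩ := Finset.exists_of_ssubset (hG.ssubset_of_ne hne)
    exact Finset.prod_eq_zero hi (by simp [hiG])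
  · refine VectorMeasure.integral_eq_zero_of_ae ?_
    filter_upwards [(concentratedOn_cubeMeasure E).ae (measurableSet_stratum E)] with x hx
    exact mono_eq_zero_of_mem_stratum ha.1 hx hG

theorem moment_cubeMeasure_self {E : Finset (Fin n)} {a : Fin n → ℝ} (ha : Admissible E a) :
    moment E a (cubeMeasure E) ≠ 0 := by
  rw [moment_cubeMeasure ha subset_rfl, Finset.prod_ne_zero_iff]
  intro i hi
  have h : (1 : ℝ) < 2 ^ a i := Real.one_lt_rpow one_lt_two (ha.1 i hi)
  rw [if_pos hi]
  linarith

/-- Radial projection and unconditional averaging move the cube measure to an unconditional measure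
on `B_E` without changing its moments. -/
theorem exists_uncMeasure {E : Finset (Fin n)} (hE : E.Nonempty) :
    ∃ μ ∈ uncMeasures (sphStratum E), μ ≠ 0 ∧
      ∀ G, G ≠ E → ∀ a, Admissible G a → moment G a μ = 0 := by
  have hc := normIntegrable_cubeMeasure E
  have hS := concentratedOn_radialProj_sphStratum hc (concentratedOn_cubeMeasure E)
  have hr : NormIntegrable (radialProj (cubeMeasure E)) :=
    (hS.mono (sphStratum_subset E)).normIntegrable
  have hm {G : Finset (Fin n)} {a : Fin n → ℝ} (ha : Admissible G a) :
      moment G a (uncAverage (radialProj (cubeMeasure E))) = moment G a (cubeMeasure E) := by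
    rw [moment_uncAverage ha hr, moment_radialProj ha hc]
  refine ⟨uncAverage (radialProj (cubeMeasure E)),
    ⟨hS.uncAverage fun F x => reflection_mem_sphStratum, isUnconditional_uncAverage _⟩,
    fun h0 => ?_, fun G hG a ha => by rw [hm ha, moment_cubeMeasure_of_ne ha hG]⟩
  have ha := admissible_uniformExp hE
  refine moment_cubeMeasure_self ha ?_
  rw [← hm ha, h0, moment_zero]

/-! ### Universality in terms of moments -/

theorem sphericallyUniversal_sphStratum_iff {ν : SM n} (hν : NormIntegrable ν)
    {E : Finset (Fin n)} (hE : E.Nonempty) :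
    SphericallyUniversal ν (uncMeasures (sphStratum E)) ↔
      ∃ a, Admissible E a ∧ moment E a ν ≠ 0 := by
  constructor
  · intro h
    by_contra! hc
    -- For this `μ` every moment of `ν ⊛ μ` vanishes: those of type `E` because of `ν`, all others
    -- because of `μ`.
    obtain ⟨μ, hμ, hμ0, hG⟩ := exists_uncMeasure hE
    have hi : NormIntegrable μ := (hμ.1.mono (sphStratum_subset E)).normIntegrable
    refine hμ0 (h μ hμ (eq_zero_of_forall_moment_eq_zero
      (concentratedOn_radialProj (hν.mulConv hi)) (isUnconditional_sphConv hν hi hμ.2)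
      fun G _ a ha => ?_))
    rw [moment_sphConv ha hν hi]
    by_cases hGE : G = E
    · subst hGE
      rw [hc a ha, zero_mul]
    · rw [hG G hGE a ha, mul_zero]
  · rintro ⟨a, ha, hne⟩ μ hμ h0
    have hi : NormIntegrable μ := (hμ.1.mono (sphStratum_subset E)).normIntegrable
    refine eq_zero_of_moment_eq_zero hE hμ.1 hμ.2 ?_
    refine (moment_eq_zero_or_of_mul_eq_zero hν hi fun c hc => ?_).resolve_left
      fun H => hne (H a ha)
    rw [← moment_sphConv hc hν hi, h0, moment_zero]

theorem sphericallyUniversal_unitSphere_iff {ν : SM n} (hν : NormIntegrable ν) :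
    SphericallyUniversal ν (uncMeasures (unitSphere n)) ↔
      ∀ E : Finset (Fin n), E.Nonempty → ∃ a, Admissible E a ∧ moment E a ν ≠ 0 := by
  constructor
  · intro h E hE
    refine (sphericallyUniversal_sphStratum_iff hν hE).1 fun μ hμ h0 => h μ ⟨?_, hμ.2⟩ h0
    exact hμ.1.mono (sphStratum_subset E)
  · intro h μ hμ h0
    have hi : NormIntegrable μ := hμ.1.normIntegrable
    refine eq_zero_of_forall_moment_eq_zero hμ.1 hμ.2 fun E hE => ?_
    obtain ⟨a, ha, hne⟩ := h E hE
    refine (moment_eq_zero_or_of_mul_eq_zero hν hi fun c hc => ?_).resolve_left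
      fun H => hne (H a ha)
    rw [← moment_sphConv hc hν hi, h0, moment_zero]

/-- A part of order `E` of an unconditional measure vanishes if and only if its moments do. -/
theorem coordPart_ne_zero_iff {σ : SM n} (hσ : ConcentratedOn σ (unitSphere n))
    (hu : IsUnconditional σ) {E : Finset (Fin n)} (hE : E.Nonempty) :
    coordPart E σ ≠ 0 ↔ ∃ a, Admissible E a ∧ moment E a (coordPart E σ) ≠ 0 := by
  constructor
  · intro h
    by_contra! hc
    exact h (eq_zero_of_moment_eq_zero hE (hσ.coordPart E) (hu.coordPart E) hc)
  · rintro ⟨a, -, hne⟩ h0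
    rw [h0, moment_zero] at hne
    exact hne rfl

theorem moment_coordPart_univ {ν : SM n} (hν : NormIntegrable ν) {a : Fin n → ℝ}
    (ha : Admissible Finset.univ a) :
    moment Finset.univ a (coordPart Finset.univ ν) = moment Finset.univ a ν :=
  (moment_eq_moment_coordPart ha hν fun _ hG hne =>
    absurd (Finset.univ_subset_iff.1 hG) hne).symm

theorem hasDegree_iff {ν : SM n} : HasDegree ν n ↔ coordPart Finset.univ ν ≠ 0 := by
  constructor
  · rintro ⟨⟨E, hE, h⟩, -⟩
    rwa [(Finset.card_eq_iff_eq_univ E).1 (by simpa using hE)] at h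
  · intro h
    refine ⟨⟨Finset.univ, by simp, h⟩, ?_⟩
    rintro m ⟨E, rfl, -⟩
    simpa using Finset.card_le_univ E

/-! ### Symmetrized one-dimensional projections -/

theorem symAverage_apply (σ : SM n) {B : Set (Rn n)} (hB : MeasurableSet B) :
    symAverage σ B =
      1 / 2 * (σ (reflection ∅ ⁻¹' B) + σ (reflection Finset.univ ⁻¹' B)) := by
  simp [symAverage, reflMeasure_apply _ _ hB, mul_add]

theorem sphProj_apply {ν : SM n} (hν : NormIntegrable ν) (E : Finset (Fin n)) {B : Set (Rn n)}
    (hB : MeasurableSet B) :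
    sphProj E ν B =
      sint ν fun x => ‖coordProj E x‖ *
        B.indicator (fun _ => 1) (radialMap (coordProj E x)) := by
  have hg : Measurable fun x : Rn n => ‖x‖ * B.indicator (fun _ => (1 : ℝ)) (radialMap x) :=
    measurable_norm.mul ((measurable_const.indicator hB).comp measurable_radialMap)
  rw [sphProj, radialProj_apply_eq_sint (hν.projMeasure E) hB, projMeasure,
    sint_map (measurable_coordProj E) hg]
  · rfl
  · refine hν.of_le (hg.comp (measurable_coordProj E)) fun x => ?_
    rw [Function.comp_apply, abs_mul, abs_norm]
    exact (mul_le_of_le_one_right (norm_nonneg _) (indicator_le_one B _)).trans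
      (norm_coordProj_le E x)

theorem coordProj_singleton (i : Fin n) (x : Rn n) :
    coordProj {i} x = x i • EuclideanSpace.single i (1 : ℝ) := by
  ext j
  by_cases h : j = i
  · subst h
    simp
  · simp [h]

/-- The projection of `x` to the `i`-th axis has direction `±e_i`; summing over both signs forgets
which. -/
theorem norm_mul_indicator_add_indicator (i : Fin n) (B : Set (Rn n)) (x : Rn n) :
    ‖coordProj {i} x‖ * ((reflection ∅ ⁻¹' B).indicator (fun _ => (1 : ℝ))
        (radialMap (coordProj {i} x)) +
      (reflection Finset.univ ⁻¹' B).indicator (fun _ => (1 : ℝ))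
        (radialMap (coordProj {i} x))) =
    (B.indicator (fun _ => (1 : ℝ)) (EuclideanSpace.single i (1 : ℝ)) +
      B.indicator (fun _ => (1 : ℝ)) (-EuclideanSpace.single i (1 : ℝ))) * |x i| := by
  set e : Rn n := EuclideanSpace.single i (1 : ℝ)
  have h0 : reflection (∅ : Finset (Fin n)) = id := by
    ext y j
    simp
  have h1 : reflection (Finset.univ : Finset (Fin n)) = fun y => -y := by
    ext y j
    simp
  have he : ‖x i • e‖ = |x i| := by simp [e, norm_smul]
  have hs (y : Rn n) : ((fun y : Rn n => -y) ⁻¹' B).indicator (fun _ => (1 : ℝ)) y =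
      B.indicator (fun _ => (1 : ℝ)) (-y) := rfl
  rw [coordProj_singleton, h0, h1, Set.preimage_id, hs, radialMap, he, smul_smul]
  rcases lt_trichotomy (x i) 0 with h | h | h
  · have h2 : (-x i)⁻¹ * x i = -1 := by
      rw [inv_neg, neg_mul, inv_mul_cancel₀ h.ne]
    rw [abs_of_neg h, h2, neg_smul, one_smul, neg_neg]
    ring
  · simp [h]
  · rw [abs_of_pos h, inv_mul_cancel₀ h.ne', one_smul]
    ring

/-- So the symmetrized projection consists of two equal atoms at `±e_i`, and its only parameter is
the integral of `|x i|`. -/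
theorem symAverage_sphProj_apply {ν : SM n} (hν : NormIntegrable ν) (i : Fin n) {B : Set (Rn n)}
    (hB : MeasurableSet B) :
    symAverage (sphProj {i} ν) B =
      1 / 2 * ((B.indicator (fun _ => (1 : ℝ)) (EuclideanSpace.single i (1 : ℝ)) +
        B.indicator (fun _ => (1 : ℝ)) (-EuclideanSpace.single i (1 : ℝ))) *
          sint ν fun x => |x i|) := by
  have hint {C : Set (Rn n)} (hC : MeasurableSet C) : ν.Integrable fun x =>
      ‖coordProj {i} x‖ * C.indicator (fun _ => (1 : ℝ)) (radialMap (coordProj {i} x)) := by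
    refine hν.of_le ((measurable_norm.comp (measurable_coordProj _)).mul
      ((measurable_const.indicator hC).comp
        (measurable_radialMap.comp (measurable_coordProj _)))) fun x => ?_
    rw [abs_mul, abs_norm]
    exact (mul_le_of_le_one_right (norm_nonneg _) (indicator_le_one C _)).trans
      (norm_coordProj_le _ x)
  rw [symAverage_apply _ hB, sphProj_apply hν _ (measurable_reflection _ hB),
    sphProj_apply hν _ (measurable_reflection _ hB), sint, sint,
    ← VectorMeasure.integral_fun_add (hint (measurable_reflection _ hB))
      (hint (measurable_reflection _ hB))]
  simp_rw [← mul_add, norm_mul_indicator_add_indicator]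
  congr 1
  exact VectorMeasure.integral_fun_smul _ _ _ _

theorem symAverage_sphProj_ne_zero_iff {ν : SM n} (hν : NormIntegrable ν) (i : Fin n) :
    symAverage (sphProj {i} ν) ≠ 0 ↔ sint ν (fun x => |x i|) ≠ 0 := by
  refine not_congr ⟨fun h => ?_, fun h => ?_⟩
  · have h1 := symAverage_sphProj_apply hν i MeasurableSet.univ
    rw [h] at h1
    simpa using h1.symm
  · ext B hB
    rw [symAverage_sphProj_apply hν i hB, h]
    simp

theorem mono_of_eq_single {E : Finset (Fin n)} {i : Fin n} (hi : i ∈ E) (x : Rn n) :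
    mono E (Pi.single i 1) x = |x i| := by
  rw [mono, Finset.prod_eq_single_of_mem i hi]
  · simp
  · intro j _ hj
    simp [hj]

theorem IsOfOrder.ae_ne_zero {ν : SM n} (h : IsOfOrder ν Finset.univ) :
    ∀ᵐ x ∂ν.variation, ∀ i, x i ≠ 0 := by
  have h1 : ∀ᵐ x ∂ν.variation, ∀ F : Finset (Fin n), F ≠ Finset.univ → x ∉ stratum F :=
    ae_all_iff.2 fun F => Filter.eventually_imp_distrib_left.2 fun hF => measure_eq_zero_iff_ae_notMem.1 (h.2 F hF)
  filter_upwards [h1] with x hx i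
  have h2 : supp x = Finset.univ := by
    by_contra hc
    exact hx _ hc (mem_stratum_iff.2 rfl)
  exact (mem_stratum_iff.2 h2 i).2 (Finset.mem_univ i)

theorem exists_moment_ne_zero_of_order_univ {ν : SM n} (hν : NormIntegrable ν)
    (h : IsOfOrder ν Finset.univ) {E : Finset (Fin n)} {i : Fin n} (hi : i ∈ E)
    (hne : sint ν (fun x => |x i|) ≠ 0) : ∃ a, Admissible E a ∧ moment E a ν ≠ 0 := by
  by_contra! hc
  set u := uniformExp E
  have hu : Admissible E u := admissible_uniformExp ⟨i, hi⟩
  -- A segment from the vertex `e_i` of the simplex, itself not admissible if `E` has other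
  -- elements, towards the uniform exponents.
  set a : ℝ → Fin n → ℝ := fun s => Pi.single i 1 + s • (u - Pi.single i 1)
  have ha : ∀ᶠ s : ℝ in nhdsWithin 0 (Set.Ioi 0), Admissible E (a s) := by
    filter_upwards [Ioo_mem_nhdsGT (zero_lt_one (α := ℝ))] with s hs
    refine ⟨fun k hk => ?_, ?_⟩
    · have hk' := hu.1 k hk
      have h1 : 0 ≤ (Pi.single i 1 : Fin n → ℝ) k := by
        by_cases hki : k = i
        · subst hki
          simp
        · simp [hki]
      have h2 : a s k = (1 - s) * (Pi.single i 1 : Fin n → ℝ) k + s * u k := by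
        simp only [a, Pi.add_apply, Pi.smul_apply, Pi.sub_apply, smul_eq_mul]
        ring
      rw [h2]
      exact add_pos_of_nonneg_of_pos (mul_nonneg (by linarith [hs.2]) h1) (mul_pos hs.1 hk')
    · have h3 : ∑ k ∈ E, (Pi.single i 1 : Fin n → ℝ) k = 1 := by simp [hi]
      simp only [a, Pi.add_apply, Pi.smul_apply, Pi.sub_apply, smul_eq_mul,
        Finset.sum_add_distrib, ← Finset.mul_sum, Finset.sum_sub_distrib, h3, hu.2]
      ring
  have hlim : Filter.Tendsto (fun s => moment E (a s) ν) (nhdsWithin 0 (Set.Ioi 0))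
      (nhds (sint ν fun x => |x i|)) := by
    refine VectorMeasure.tendsto_integral_filter_of_dominated_convergence (fun x => ‖x‖)
      (Filter.Eventually.of_forall fun s => (measurable_mono E (a s)).aestronglyMeasurable)
      ?_ hν ?_
    · filter_upwards [ha] with s hs
      refine Filter.Eventually.of_forall fun x => ?_
      rw [Real.norm_of_nonneg (mono_nonneg _ _ _)]
      exact mono_le_norm hs x
    -- Order `[n]` matters here: for `k ≠ i` in `E`, `|x k|` raised to a power tending to zero tends
    -- to one only because `x k ≠ 0`.
    · filter_upwards [h.ae_ne_zero] with x hx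
      rw [← mono_of_eq_single hi]
      refine tendsto_finsetProd _ fun k _ => ?_
      refine Filter.Tendsto.mono_left ?_ nhdsWithin_le_nhds
      have hk : Continuous fun s : ℝ => |x k| ^ a s k := by
        refine Continuous.rpow continuous_const ?_ fun s => Or.inl (abs_ne_zero.2 (hx k))
        simp only [a, Pi.add_apply, Pi.smul_apply, smul_eq_mul]
        fun_prop
      refine hk.tendsto' 0 _ ?_
      simp [a]
  refine hne (tendsto_nhds_unique hlim (tendsto_const_nhds.congr' ?_))
  filter_upwards [ha] with s hs
  exact (hc _ hs).symm

/-! ### Non-negative measures -/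

/-- The monomial is non-negative, and positive on `A_[n]`; a zero integral would make that stratum
null. -/
theorem moment_ne_zero_of_nonneg {ν : SM n} (hν : NormIntegrable ν) (h0 : 0 ≤ ν)
    (h : coordPart Finset.univ ν ≠ 0) {E : Finset (Fin n)} {a : Fin n → ℝ}
    (ha : Admissible E a) : moment E a ν ≠ 0 := by
  obtain ⟨m, hm, rfl⟩ : ∃ (m : Measure (Rn n)) (_ : IsFiniteMeasure m), m.toSignedMeasure = ν :=
    ⟨_, SignedMeasure.toMeasureOfZeroLE_finite _ _ _,
      SignedMeasure.toMeasureOfZeroLE_toSignedMeasure ν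
        ((VectorMeasure.le_restrict_univ_iff_le _ _).2 h0)⟩
  have hi : Integrable (mono E a) m := by
    have := hν.mono ha
    rwa [VectorMeasure.Integrable, Measure.variation_toSignedMeasure] at this
  intro hc
  rw [moment, sint, VectorMeasure.integral_toSignedMeasure,
    integral_eq_zero_iff_of_nonneg (mono_nonneg E a) hi] at hc
  refine h ?_
  have hz : m (stratum Finset.univ) = 0 := by
    rw [measure_eq_zero_iff_ae_notMem]
    filter_upwards [hc] with x hx hxs
    obtain ⟨i, -, hi0⟩ := (mono_eq_zero_iff ha.1 x).1 hx
    exact (hxs i).2 (Finset.mem_univ i) hi0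
  ext B hB
  rw [coordPart_apply _ _ hB,
    Measure.toSignedMeasure_apply_measurable (hB.inter (measurableSet_stratum _)), measureReal_def,
    measure_mono_null Set.inter_subset_right hz]
  simp

end SphConv

end

/-! ### The four criteria for universality -/

theorem mainTheorem7 (n : ℕ) (hn : 1 ≤ n) (ν : SphConv.SM n)
    (hν : SphConv.ConcentratedOn ν (SphConv.unitSphere n)) :
    (SphConv.SphericallyUniversal ν (SphConv.uncMeasures (SphConv.sphStratum Finset.univ)) ↔
      SphConv.HasDegree (SphConv.uncAverage ν) n) ∧
    (SphConv.SphericallyUniversal ν (SphConv.uncMeasures (SphConv.unitSphere n)) ↔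
      ∀ E : Finset (Fin n), E.Nonempty →
        SphConv.coordPart E (SphConv.sphProj E (SphConv.uncAverage ν)) ≠ 0) ∧
    (SphConv.IsOfOrder ν Finset.univ →
      (SphConv.SphericallyUniversal ν (SphConv.uncMeasures (SphConv.unitSphere n)) ↔
        ∀ i : Fin n, SphConv.symAverage (SphConv.sphProj {i} ν) ≠ 0)) ∧
    (0 ≤ ν →
      (SphConv.SphericallyUniversal ν (SphConv.uncMeasures (SphConv.unitSphere n)) ↔
        SphConv.HasDegree ν n)) := by
  open SphConv in
  have hi : NormIntegrable ν := hν.normIntegrable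
  have hU : IsUnconditional (uncAverage ν) := isUnconditional_uncAverage ν
  have hUS : ConcentratedOn (uncAverage ν) (unitSphere n) :=
    hν.uncAverage fun F x => reflection_mem_unitSphere
  have huniv : (Finset.univ : Finset (Fin n)).Nonempty := ⟨⟨0, hn⟩, Finset.mem_univ _⟩
  refine ⟨?_, ?_, fun hord => ?_, fun h0 => ?_⟩
  · rw [sphericallyUniversal_sphStratum_iff hi huniv, hasDegree_iff,
      coordPart_ne_zero_iff hUS hU huniv]
    refine exists_congr fun a => and_congr_right fun ha => ?_
    rw [moment_coordPart_univ hi.uncAverage ha, moment_uncAverage ha hi]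
  · rw [sphericallyUniversal_unitSphere_iff hi]
    refine forall₂_congr fun E hE => ?_
    have hS : ConcentratedOn (sphProj E (uncAverage ν)) (unitSphere n) :=
      concentratedOn_radialProj (hi.uncAverage.projMeasure E)
    rw [coordPart_ne_zero_iff hS (isUnconditional_sphProj hi.uncAverage hU E) hE]
    refine exists_congr fun a => and_congr_right fun ha => ?_
    rw [moment_coordPart_sphProj ha hi.uncAverage, moment_uncAverage ha hi]
  · rw [sphericallyUniversal_unitSphere_iff hi]
    simp_rw [symAverage_sphProj_ne_zero_iff hi]
    constructor
    · intro h i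
      obtain ⟨a, ha, hne⟩ := h {i} (Finset.singleton_nonempty i)
      -- On a singleton the only admissible exponent is `1`, so the moment is the integral of `|x
      -- i|`.
      have hai : a i = 1 := by simpa using ha.2
      have hm : mono {i} a = fun x : Rn n => |x i| := by
        ext x
        simp [mono, hai]
      rwa [moment, hm] at hne
    -- A single coordinate of `E` suffices: the non-zero limit at its vertex forces a non-zero
    -- moment nearby.
    · rintro h E ⟨i, hiE⟩
      exact exists_moment_ne_zero_of_order_univ hi hord hiE (h i)
  · rw [sphericallyUniversal_unitSphere_iff hi, hasDegree_iff]
    constructor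
    · intro h hz
      obtain ⟨a, ha, hne⟩ := h _ huniv
      rw [← moment_coordPart_univ hi ha, hz, moment_zero] at hne
      exact hne rfl
    · intro h E hE
      exact ⟨_, admissible_uniformExp hE,
        moment_ne_zero_of_nonneg hi h0 h (admissible_uniformExp hE)⟩
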